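/- Let $n\ge 1$, $d=n+1$, let $e_0,\dots,e_n$ be an orthonormal basis of $\mathbb C^d$, let $\Lambda=(\lambda_0,\dots,\lambda_n)$ with $\lambda_0=1$ and $\lambda_i>0$ for all $i$, and let $\Theta=(\theta_{ij})_{0\le i<j\le n}$ be real numbers. Let $h$ be the orthogonal projection in $\mathbb C^d\otimes\mathbb C^d$ onto the span of the vectors $$\phi^{ij}=e_i\otimes e_j-e^{\mathrm i\theta_{ij}}\lambda_i^{-1}\lambda_j\,e_j\otimes e_i\quad(0\le i<j\le n),\qquad \phi^{ii}=e_i\otimes e_i\quad(1\le i\le n).$$ For $N\ge 2$ let $H_N=\sum_{x=1}^{N-1}h_{x,x+1}$ on $(\mathbb C^d)^{\otimes N}$, where $h_{x,x+1}$ is the copy of $h$ acting on the sites $x$ and $x+1$ (the PVBS Hamiltonian on a chain of length $N$), and let $\gamma(\Lambda,\Theta,N)$ be its spectral gap, that is, the difference between the smallest and the next-smallest (distinct) eigenvalue of $H_N$. **Proposition 2.1 (Gap bounds).** (i) For $1\le i\le n$ with $\lambda_i\ne1$ put $C_i=(1+\lambda_i)/|1-\lambda_i|$ (so that $C_i>1$).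 For every such $i$ and every integer $N>C_i$, $$\gamma(\Lambda,\Theta,N)\le\Bigl(1-\frac{2}{\lambda_i^{-1}+\lambda_i}\Bigr)\Bigl(1+\frac{C_i-1}{N-C_i}\Bigr);$$ in other words, $\gamma(\Lambda,\Theta,N)$ is at most the minimum of the right-hand sides over all $i\in\{1,\dots,n\}$ with $\lambda_i\neq1$ and $C_i<N$, whenever there is such an $i$. (ii) If $\lambda_i\ne1$ for all $1\le i\le n$, then $\displaystyle\inf_{N\ge2}\gamma(\Lambda,\Theta,N)>0$. -/

import Mathlib

noncomputable section

namespace PVBS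

/-- The two-site space `ℂ^d ⊗ ℂ^d`, `d = n + 1`, in the orthonormal product basis
`e_i ⊗ e_j`, which is labelled by the pairs `(i, j)`. -/
abbrev TwoSite (n : ℕ) : Type := EuclideanSpace ℂ (Fin (n + 1) × Fin (n + 1))

/-- The space `ℂ^d ⊗ ⋯ ⊗ ℂ^d` (`N` factors, `d = n + 1`) of a chain of `N` sites, in the
orthonormal product basis `e_{σ 0} ⊗ ⋯ ⊗ e_{σ (N-1)}`, which is labelled by the
configurations `σ`. -/
abbrev Chain (n N : ℕ) : Type := EuclideanSpace ℂ (Fin N → Fin (n + 1))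

variable {n : ℕ}

/-- The product basis vector `e_i ⊗ e_j`. -/
def basisPair (i j : Fin (n + 1)) : TwoSite n := EuclideanSpace.single (i, j) 1

/-- `φ^{ij} = e_i ⊗ e_j - exp(i θ_{ij}) λ_i⁻¹ λ_j e_j ⊗ e_i`. -/
def phi (lam : Fin (n + 1) → ℝ) (θ : Fin (n + 1) → Fin (n + 1) → ℝ) (i j : Fin (n + 1)) :
    TwoSite n :=
  basisPair i j -
    (Complex.exp (Complex.I * (θ i j : ℂ)) * ((lam i : ℂ))⁻¹ * (lam j : ℂ)) • basisPair j i

/-- The span of the `φ^{ij}` with `0 ≤ i < j ≤ n` and of the `φ^{ii} = e_i ⊗ e_i` with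
`1 ≤ i ≤ n`. -/
def excitedSpace (lam : Fin (n + 1) → ℝ) (θ : Fin (n + 1) → Fin (n + 1) → ℝ) :
    Submodule ℂ (TwoSite n) :=
  Submodule.span ℂ
    ({v | ∃ i j : Fin (n + 1), i < j ∧ v = phi lam θ i j} ∪
      {v | ∃ i : Fin (n + 1), i ≠ 0 ∧ v = basisPair i i})

/-- The nearest-neighbour interaction `h`: the orthogonal projection onto `excitedSpace`. -/
def interaction (lam : Fin (n + 1) → ℝ) (θ : Fin (n + 1) → Fin (n + 1) → ℝ) :
    TwoSite n →ₗ[ℂ] TwoSite n :=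
  (excitedSpace lam θ).starProjection.toLinearMap

/-- The two-site vector that one obtains from `ψ` when the configuration is frozen to `σ` at
all sites other than `x` and `y`. -/
def slice {N : ℕ} (x y : Fin N) (σ : Fin N → Fin (n + 1)) : Chain n N →ₗ[ℂ] TwoSite n where
  toFun ψ := WithLp.toLp 2 fun p => ψ (Function.update (Function.update σ x p.1) y p.2)
  map_add' _ _ := by ext; simp
  map_smul' _ _ := by ext; simp

/-- The copy `T_{x,y}` of a two-site operator `T` that acts on the sites `x` and `y` and as the
identity on all the other sites. -/
def actOn {N : ℕ} (T : TwoSite n →ₗ[ℂ] TwoSite n) (x y : Fin N) :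
    Chain n N →ₗ[ℂ] Chain n N where
  toFun ψ := WithLp.toLp 2 fun σ => T (slice x y σ ψ) (σ x, σ y)
  map_add' _ _ := by ext; simp
  map_smul' _ _ := by ext; simp

/-- The Hamiltonian `∑_x h_{x,x+1}` on a chain of `N` sites with open boundary conditions. -/
def hamiltonian (lam : Fin (n + 1) → ℝ) (θ : Fin (n + 1) → Fin (n + 1) → ℝ) (N : ℕ) :
    Chain n N →ₗ[ℂ] Chain n N :=
  ∑ p : Fin N × Fin N with p.1.val + 1 = p.2.val, actOn (interaction lam θ) p.1 p.2

/-- The set of real eigenvalues of an operator on a complex vector space. -/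
def energies {V : Type*} [AddCommGroup V] [Module ℂ V] (T : V →ₗ[ℂ] V) : Set ℝ :=
  {E : ℝ | Module.End.HasEigenvalue T (E : ℂ)}

/-- The smallest eigenvalue. -/
def groundEnergy {V : Type*} [AddCommGroup V] [Module ℂ V] (T : V →ₗ[ℂ] V) : ℝ :=
  sInf (energies T)

/-- The difference between the smallest eigenvalue and the next-smallest (distinct)
eigenvalue. -/
def spectralGap {V : Type*} [AddCommGroup V] [Module ℂ V] (T : V →ₗ[ℂ] V) : ℝ :=
  sInf {E ∈ energies T | groundEnergy T < E} - groundEnergy T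

/-- The gap `γ(Λ, Θ, N)` on a chain of `N` sites. -/
def gap (lam : Fin (n + 1) → ℝ) (θ : Fin (n + 1) → Fin (n + 1) → ℝ) (N : ℕ) : ℝ :=
  spectralGap (hamiltonian lam θ N)

/-- The constant `C_i = (1 + λ_i) / |1 - λ_i|` as a function of `λ_i`. -/
def boundConst (l : ℝ) : ℝ := (1 + l) / |1 - l|

end PVBS

end

open Finset
open scoped ComplexConjugate

namespace PVBS

variable {n : ℕ}

/-! ### Amplitude ratios under exchange of two species. -/

section SwapRatio

variable (lam : Fin (n + 1) → ℝ) (θ : Fin (n + 1) → Fin (n + 1) → ℝ)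

/-! Every bond term is an orthogonal projection and the vacuum is annihilated by all of them, so the
ground energy is 0 and the gap is the least positive eigenvalue (`gap_eq`).

Upper bound. With a single particle of species `i` present, each bond acts as a rank-one operator.
On combinations of the vectors spanning these ranges the Hamiltonian is tridiagonal and is
diagonalized by a sine profile; the lowest mode has energy `1 - 2 / (λ⁻¹ + λ) * cos (π / N)`
(`oneParticleEnergy_mem_energies`), and an elementary estimate of the cosine finishes
(`oneParticleEnergy_le`).

Lower bound, by the martingale method. Divided by an explicit nowhere vanishing gauge, ground states
of an interval are exactly the permutation invariant functions that vanish when a nonvacuum species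
occurs twice (`mem_groundSpace_iff`). Moving a particle of weight `λ` from site `x` to an empty site
`y` therefore multiplies the modulus by `λ ^ (y - x)`. Among any `n + 1` sites with at least one
particle some site is empty or some species repeats, so particles with `λ < 1` cluster at the left
end and those with `λ > 1` at the right end, up to exponentially small weight.

Cut an interval in two. If all particles are on their preferred side, a ground state of both halves
is the sorted part of a ground state of the whole (`exists_extension`), because no nonvacuum species
has `λ = 1`. Hence excitations created by adding one site are almost orthogonal to the ground states
of a long enough final block (`norm_inner_groundSpace_le`). This overlap bound, the
finite-dimensional gap of blocks of fixed length (`exists_gap_blocks`) and a telescoping sum over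
the added sites (`norm_sq_step_le`) give a gap independent of `N` (`exists_uniform_gap`). -/

/-- The phase attached to an ordered pair of species in a ground state. -/
noncomputable def pairPhase (i j : Fin (n + 1)) : ℂ :=
  if i < j then Complex.exp (-(Complex.I * (θ i j : ℂ))) else 1

/-- The ratio `ψ(… i j …) / ψ(… j i …)` of the amplitudes of a ground state. -/
noncomputable def swapRatio (i j : Fin (n + 1)) : ℂ :=
  (lam j : ℂ) / (lam i : ℂ) * (pairPhase θ i j / pairPhase θ j i)

/-- The weight of the exchange term in the interaction. -/
noncomputable def swapWeight (i j : Fin (n + 1)) : ℝ := lam i ^ 2 / (lam i ^ 2 + lam j ^ 2)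

lemma pairPhase_ne_zero (i j : Fin (n + 1)) : pairPhase θ i j ≠ 0 := by
  unfold pairPhase; split_ifs <;> simp [Complex.exp_ne_zero]

lemma norm_pairPhase (i j : Fin (n + 1)) : ‖pairPhase θ i j‖ = 1 := by
  unfold pairPhase; split_ifs
  · rw [Complex.norm_exp]; simp
  · simp

variable {lam}

lemma swapRatio_mul_swapRatio (hlam : ∀ i, 0 < lam i) (i j : Fin (n + 1)) :
    swapRatio lam θ i j * swapRatio lam θ j i = 1 := by
  have h1 : (lam i : ℂ) ≠ 0 := by exact_mod_cast (hlam i).ne'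
  have h2 : (lam j : ℂ) ≠ 0 := by exact_mod_cast (hlam j).ne'
  have h3 := pairPhase_ne_zero θ i j
  have h4 := pairPhase_ne_zero θ j i
  unfold swapRatio
  field_simp

lemma swapRatio_ne_zero (hlam : ∀ i, 0 < lam i) (i j : Fin (n + 1)) :
    swapRatio lam θ i j ≠ 0 :=
  left_ne_zero_of_mul_eq_one (swapRatio_mul_swapRatio θ hlam i j)

lemma norm_swapRatio (hlam : ∀ i, 0 < lam i) (i j : Fin (n + 1)) :
    ‖swapRatio lam θ i j‖ = lam j / lam i := by
  simp [swapRatio, norm_pairPhase, abs_of_pos (hlam _)]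

lemma conj_swapRatio (hlam : ∀ i, 0 < lam i) (i j : Fin (n + 1)) :
    conj (swapRatio lam θ i j) = ((lam j / lam i : ℝ) : ℂ) ^ 2 * swapRatio lam θ j i := by
  have h := Complex.conj_mul' (swapRatio lam θ i j)
  rw [norm_swapRatio θ hlam] at h
  rw [← h, mul_assoc, swapRatio_mul_swapRatio θ hlam, mul_one]

lemma swapWeight_add_swapWeight (hlam : ∀ i, 0 < lam i) (i j : Fin (n + 1)) :
    swapWeight lam i j + swapWeight lam j i = 1 := by
  have := hlam i
  have := hlam j
  unfold swapWeight
  rw [add_comm (lam j ^ 2)]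
  field_simp

/-- Hermiticity of the 2×2 block of the interaction on `e_i ⊗ e_j` and `e_j ⊗ e_i`. -/
lemma swapWeight_mul_conj_swapRatio (hlam : ∀ i, 0 < lam i) (i j : Fin (n + 1)) :
    (swapWeight lam i j : ℂ) * conj (swapRatio lam θ i j) =
      swapWeight lam j i * swapRatio lam θ j i := by
  rw [conj_swapRatio θ hlam, ← mul_assoc]
  congr 1
  norm_cast
  have := hlam i
  have := hlam j
  unfold swapWeight
  rw [add_comm (lam j ^ 2)]
  field_simp

lemma swapRatio_of_lt {i j : Fin (n + 1)} (h : i < j) :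
    swapRatio lam θ i j =
      conj (Complex.exp (Complex.I * (θ i j : ℂ)) * ((lam i : ℂ))⁻¹ * (lam j : ℂ)) := by
  simp only [swapRatio, pairPhase, h, if_true, h.not_gt, if_false, map_mul, ← Complex.exp_conj,
    Complex.conj_I, Complex.conj_ofReal, map_inv₀]
  rw [neg_mul]
  ring

end SwapRatio

/-! ### Matrix elements of the two-site projection. -/

section Interaction

variable {lam : Fin (n + 1) → ℝ} (θ : Fin (n + 1) → Fin (n + 1) → ℝ)

lemma inner_phi {i j : Fin (n + 1)} (h : i < j) (v : TwoSite n) :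
    inner ℂ (phi lam θ i j) v = v (i, j) - swapRatio lam θ i j * v (j, i) := by
  rw [swapRatio_of_lt θ h, phi, basisPair, basisPair, inner_sub_left, inner_smul_left,
    EuclideanSpace.inner_single_left, EuclideanSpace.inner_single_left]
  simp

/-- The interaction in the product basis. -/
lemma interaction_apply (hlam : ∀ i, 0 < lam i) (v : TwoSite n) (i j : Fin (n + 1)) :
    interaction lam θ v (i, j) =
      if i = j then (if i = 0 then 0 else v (i, j)) else
        swapWeight lam i j * (v (i, j) - swapRatio lam θ i j * v (j, i)) := by
  set w : TwoSite n := WithLp.toLp 2 fun p =>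
    if p.1 = p.2 then (if p.1 = 0 then 0 else v p) else
        swapWeight lam p.1 p.2 * (v p - swapRatio lam θ p.1 p.2 * v (p.2, p.1)) with hw
  have hwv (i j) : w (i, j) = if i = j then (if i = 0 then 0 else v (i, j)) else
        swapWeight lam i j * (v (i, j) - swapRatio lam θ i j * v (j, i)) := rfl
  suffices h : interaction lam θ v = w by rw [h, hwv]
  -- The candidate `w` is the projection of `v` once `w` lies in the span and `v - w` is orthogonal
  -- to it; both follow from this description of the orthogonal complement.
  have hortho (u : TwoSite n) : u ∈ (excitedSpace lam θ)ᗮ ↔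
      (∀ i j, i < j → u (i, j) = swapRatio lam θ i j * u (j, i)) ∧ ∀ i, i ≠ 0 → u (i, i) = 0 := by
    rw [excitedSpace, Submodule.mem_orthogonal]
    constructor
    · intro h
      refine ⟨fun i j hij => ?_, fun i hi => ?_⟩
      · have := h _ (Submodule.subset_span (Or.inl ⟨i, j, hij, rfl⟩))
        rwa [inner_phi θ hij, sub_eq_zero] at this
      · have := h _ (Submodule.subset_span (Or.inr ⟨i, hi, rfl⟩))
        simpa [basisPair, EuclideanSpace.inner_single_left] using this
    · rintro ⟨h1, h2⟩ x hx
      induction hx using Submodule.span_induction with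
      | mem x hx =>
        rcases hx with ⟨i, j, hij, rfl⟩ | ⟨i, hi, rfl⟩
        · rw [inner_phi θ hij, h1 i j hij, sub_self]
        · simp [basisPair, EuclideanSpace.inner_single_left, h2 i hi]
      | zero => simp
      | add x y _ _ hx hy => rw [inner_add_left, hx, hy, add_zero]
      | smul c x _ hx => rw [inner_smul_left, hx, mul_zero]
  refine (Submodule.eq_starProjection_of_mem_orthogonal ?_ ?_)
  · rw [← Submodule.orthogonal_orthogonal (excitedSpace lam θ), Submodule.mem_orthogonal]
    intro u hu
    obtain ⟨h1, h2⟩ := (hortho u).1 hu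
    have h1' (i j) (hij : i ≠ j) : u (i, j) = swapRatio lam θ i j * u (j, i) := by
      rcases lt_or_gt_of_ne hij with h | h
      · exact h1 i j h
      · rw [h1 j i h, ← mul_assoc, swapRatio_mul_swapRatio θ hlam, one_mul]
    rw [PiLp.inner_apply]
    set X : Fin (n + 1) × Fin (n + 1) → ℂ := fun p => inner ℂ (u p) (w p) with hX
    -- The terms of the inner product are antisymmetric under exchange of the two factors, so their
    -- sum equals its own negative.
    have hneg (p) : X p.swap = - X p := by
      obtain ⟨i, j⟩ := p
      simp only [hX, Prod.swap_prod_mk, RCLike.inner_apply, hwv]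
      by_cases hij : i = j
      · subst hij
        by_cases hi : i = 0
        · simp [hi]
        · simp [hi, h2 i hi]
      · have e1 := h1' i j hij
        have e2 := swapWeight_mul_conj_swapRatio θ hlam i j
        have e3 := swapRatio_mul_swapRatio θ hlam i j
        rw [if_neg hij, if_neg (Ne.symm hij), e1, map_mul]
        linear_combination ((v (i, j) - swapRatio lam θ i j * v (j, i)) * conj (u (j, i))) * e2
          + (- swapWeight lam j i * v (j, i) * conj (u (j, i))) * e3
    have hsum : ∑ p, X p = - ∑ p, X p := by
      rw [← Finset.sum_neg_distrib]
      rw [← Equiv.sum_comp (Equiv.prodComm (Fin (n + 1)) (Fin (n + 1))) X]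
      exact Finset.sum_congr rfl fun p _ => hneg p
    exact self_eq_neg.1 hsum
  · rw [hortho]
    refine ⟨fun i j hij => ?_, fun i hi => ?_⟩
    · have e1 : (swapWeight lam i j : ℂ) + swapWeight lam j i = 1 := by
        exact_mod_cast swapWeight_add_swapWeight hlam i j
      have e3 := swapRatio_mul_swapRatio θ hlam i j
      simp only [PiLp.sub_apply, hwv, hij.ne, hij.ne', if_false]
      linear_combination (-(v (i, j) - swapRatio lam θ i j * v (j, i))) * e1
        + (- swapWeight lam j i * v (i, j)) * e3
    · simp [hwv, hi]

end Interaction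

/-! ### Bond terms of the Hamiltonian, indexed by natural numbers. -/

section Bond

variable (lam : Fin (n + 1) → ℝ) (θ : Fin (n + 1) → Fin (n + 1) → ℝ) (N : ℕ)

/-- The interaction on the sites `x` and `x + 1`. -/
noncomputable def bond (x : ℕ) : Chain n N →ₗ[ℂ] Chain n N :=
  if h : x + 1 < N then actOn (interaction lam θ) ⟨x, by omega⟩ ⟨x + 1, h⟩ else 0

lemma hamiltonian_eq_sum_bond : hamiltonian lam θ N = ∑ x ∈ range (N - 1), bond lam θ N x := by
  unfold hamiltonian
  refine Finset.sum_bij' (fun p _ => p.1.val)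
    (fun x hx => (⟨x, by simp at hx; omega⟩, ⟨x + 1, by simp at hx; omega⟩)) ?_ ?_ ?_ ?_ ?_
  · intro p hp
    simp only [mem_filter, mem_univ, true_and] at hp
    have := p.2.isLt
    simp; omega
  · intro x hx; simp
  · rintro ⟨p, q⟩ hp
    simp only [mem_filter, mem_univ, true_and] at hp
    simp [hp]
  · intro x hx; simp
  · rintro ⟨⟨p, hp'⟩, ⟨q, hq'⟩⟩ hp
    simp only [mem_filter, mem_univ, true_and] at hp
    subst hp
    simp [bond, hq']

variable {lam N}

lemma bond_apply (hlam : ∀ i, 0 < lam i) {x : ℕ} (h : x + 1 < N) {p q : Fin N}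
    (hp : p.val = x) (hq : q.val = x + 1) (ψ : Chain n N) (σ : Fin N → Fin (n + 1)) :
    bond lam θ N x ψ σ =
      if σ p = σ q then (if σ p = 0 then 0 else ψ σ) else
        swapWeight lam (σ p) (σ q) *
          (ψ σ - swapRatio lam θ (σ p) (σ q) * ψ (σ ∘ Equiv.swap p q)) := by
  subst hp
  obtain rfl : q = ⟨p.val + 1, h⟩ := Fin.ext hq
  have hpq : p ≠ ⟨p.val + 1, h⟩ := by simp [Fin.ext_iff]
  rw [bond, dif_pos h]
  simp only [actOn, LinearMap.coe_mk, AddHom.coe_mk, interaction_apply θ hlam, slice, Fin.eta]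
  have e2 : Function.update (Function.update σ p (σ ⟨p.val + 1, h⟩)) ⟨p.val + 1, h⟩ (σ p) =
      σ ∘ Equiv.swap p ⟨p.val + 1, h⟩ := by
    funext y
    simp only [Function.update_apply, Function.comp_apply, Equiv.swap_apply_def]
    split_ifs <;> simp_all
  simp only [Function.update_eq_self, e2]

lemma bond_of_le {x : ℕ} (h : ¬ x + 1 < N) : bond lam θ N x = 0 := by
  rw [bond, dif_neg h]

end Bond

/-! ### Bonds are symmetric idempotents that commute when disjoint. -/

section BondAlgebra

variable {lam : Fin (n + 1) → ℝ} (θ : Fin (n + 1) → Fin (n + 1) → ℝ) {N : ℕ}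

variable (lam) in
/-- Diagonal coefficient of the interaction between neighbouring species `i` and `j`. -/
noncomputable def diagCoeff (i j : Fin (n + 1)) : ℂ :=
  if i = j then (if i = 0 then 0 else 1) else swapWeight lam i j

variable (lam) in
/-- Exchange coefficient of the interaction between neighbouring species `i` and `j`. -/
noncomputable def exchangeCoeff (i j : Fin (n + 1)) : ℂ :=
  if i = j then 0 else swapWeight lam i j * swapRatio lam θ i j

/-- A form without case distinction: symmetry and commutation then need only the behaviour of the
two coefficients under exchange of sites. -/
lemma bond_apply_coeff (hlam : ∀ i, 0 < lam i) {x : ℕ} (h : x + 1 < N) {p q : Fin N}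
    (hp : p.val = x) (hq : q.val = x + 1) (ψ : Chain n N) (σ : Fin N → Fin (n + 1)) :
    bond lam θ N x ψ σ = diagCoeff lam (σ p) (σ q) * ψ σ -
      exchangeCoeff lam θ (σ p) (σ q) * ψ (σ ∘ Equiv.swap p q) := by
  rw [bond_apply θ hlam h hp hq, diagCoeff, exchangeCoeff]
  split_ifs <;> ring

lemma exists_sites {x : ℕ} (h : x + 1 < N) :
    ∃ p q : Fin N, p.val = x ∧ q.val = x + 1 ∧ p ≠ q :=
  ⟨⟨x, by omega⟩, ⟨x + 1, h⟩, rfl, rfl, by simp [Fin.ext_iff]⟩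

lemma conj_exchangeCoeff (hlam : ∀ i, 0 < lam i) (i j : Fin (n + 1)) :
    conj (exchangeCoeff lam θ i j) = exchangeCoeff lam θ j i := by
  unfold exchangeCoeff
  by_cases hij : i = j
  · simp [hij]
  · rw [if_neg hij, if_neg (Ne.symm hij), map_mul, Complex.conj_ofReal,
      swapWeight_mul_conj_swapRatio θ hlam]

lemma conj_diagCoeff (i j : Fin (n + 1)) : conj (diagCoeff lam i j) = diagCoeff lam i j := by
  unfold diagCoeff
  split_ifs <;> simp

lemma comp_swap_comp_swap {α β : Type*} [DecidableEq α] (σ : α → β) (p q : α) :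
    (σ ∘ Equiv.swap p q) ∘ Equiv.swap p q = σ := by
  funext y; simp

/-- Reindexing of a sum over configurations by the exchange of two sites. -/
lemma sum_comp_swap {M : Type*} [AddCommMonoid M] (p q : Fin N)
    (f : (Fin N → Fin (n + 1)) → M) :
    ∑ σ, f (σ ∘ Equiv.swap p q) = ∑ σ, f σ :=
  Equiv.sum_comp (Equiv.arrowCongr (Equiv.swap p q) (Equiv.refl (Fin (n + 1)))) f

/-- The diagonal coefficients are real, and the exchange coefficients are conjugated when the two
species are exchanged, which is undone by reindexing the sum over configurations. -/
lemma bond_isSymmetric (hlam : ∀ i, 0 < lam i) (x : ℕ) : (bond lam θ N x).IsSymmetric := by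
  intro ψ φ
  by_cases h : x + 1 < N
  swap
  · simp [bond_of_le θ h]
  obtain ⟨p, q, hp, hq, hpq⟩ := exists_sites h
  simp only [PiLp.inner_apply, RCLike.inner_apply, bond_apply_coeff θ hlam h hp hq, map_sub,
    map_mul, conj_diagCoeff, mul_sub, sub_mul, sum_sub_distrib]
  congr 1
  · exact sum_congr rfl fun σ _ => by ring
  · rw [← sum_comp_swap p q]
    refine sum_congr rfl fun σ _ => ?_
    simp only [comp_swap_comp_swap, conj_exchangeCoeff θ hlam, Function.comp_apply,
      Equiv.swap_apply_left, Equiv.swap_apply_right]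
    ring

lemma bond_bond (hlam : ∀ i, 0 < lam i) (x : ℕ) (ψ : Chain n N) :
    bond lam θ N x (bond lam θ N x ψ) = bond lam θ N x ψ := by
  by_cases h : x + 1 < N
  swap
  · simp [bond_of_le θ h]
  obtain ⟨p, q, hp, hq, hpq⟩ := exists_sites h
  ext σ
  simp only [bond_apply θ hlam h hp hq, comp_swap_comp_swap, Function.comp_apply,
      Equiv.swap_apply_left, Equiv.swap_apply_right]
  by_cases h1 : σ p = σ q
  · simp only [h1, if_true]
    split_ifs <;> rfl
  · have e1 : (swapWeight lam (σ p) (σ q) : ℂ) + swapWeight lam (σ q) (σ p) = 1 := by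
      exact_mod_cast swapWeight_add_swapWeight hlam _ _
    have e3 := swapRatio_mul_swapRatio θ hlam (σ p) (σ q)
    simp only [if_neg h1, if_neg (Ne.symm h1)]
    linear_combination (swapWeight lam (σ p) (σ q) * (ψ σ - swapRatio lam θ (σ p) (σ q) *
      ψ (σ ∘ Equiv.swap p q))) * e1
      + (swapWeight lam (σ p) (σ q) * swapWeight lam (σ q) (σ p) * ψ σ) * e3

lemma bond_comm (hlam : ∀ i, 0 < lam i) {x y : ℕ} (hxy : x + 1 < y) (ψ : Chain n N) :
    bond lam θ N x (bond lam θ N y ψ) = bond lam θ N y (bond lam θ N x ψ) := by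
  by_cases h' : y + 1 < N
  swap
  · simp [bond_of_le θ h']
  have h : x + 1 < N := by omega
  obtain ⟨p, q, hp, hq, hpq⟩ := exists_sites h
  obtain ⟨p', q', hp', hq', hpq'⟩ := exists_sites h'
  have h1 : p ≠ p' := by rintro rfl; omega
  have h2 : p ≠ q' := by rintro rfl; omega
  have h3 : q ≠ p' := by rintro rfl; omega
  have h4 : q ≠ q' := by rintro rfl; omega
  ext σ
  have e : (σ ∘ Equiv.swap p q) ∘ Equiv.swap p' q' = (σ ∘ Equiv.swap p' q') ∘ Equiv.swap p q := by
    funext z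
    simp only [Function.comp_apply]
    congr 1
    simp only [Equiv.swap_apply_def]
    split_ifs <;> simp_all
  simp only [bond_apply_coeff θ hlam h hp hq, bond_apply_coeff θ hlam h' hp' hq',
    Function.comp_apply, Equiv.swap_apply_of_ne_of_ne h1 h2, Equiv.swap_apply_of_ne_of_ne h3 h4,
    Equiv.swap_apply_of_ne_of_ne h1.symm h3.symm, Equiv.swap_apply_of_ne_of_ne h2.symm h4.symm, e]
  ring

end BondAlgebra

/-! ### Common kernels of the bonds in an interval. -/

section GroundSpace

variable (lam : Fin (n + 1) → ℝ) (θ : Fin (n + 1) → Fin (n + 1) → ℝ) (N : ℕ)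

/-- The vectors that are annihilated by all the bonds inside the interval `[a, b)`. -/
noncomputable def groundSpace (a b : ℕ) : Submodule ℂ (Chain n N) where
  carrier := {ψ | ∀ x, a ≤ x → x + 1 < b → bond lam θ N x ψ = 0}
  add_mem' h1 h2 x ha hb := by rw [map_add, h1 x ha hb, h2 x ha hb, add_zero]
  zero_mem' x _ _ := map_zero _
  smul_mem' c ψ h x ha hb := by rw [map_smul, h x ha hb, smul_zero]

variable {lam N}

lemma groundSpace_mono {a b a' b' : ℕ} (ha : a' ≤ a) (hb : b ≤ b') :
    groundSpace lam θ N a' b' ≤ groundSpace lam θ N a b :=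
  fun _ h x hx hx' => h x (ha.trans hx) (hx'.trans_le hb)

lemma bond_eq_zero_iff (hlam : ∀ i, 0 < lam i) {x : ℕ} (h : x + 1 < N) {p q : Fin N}
    (hp : p.val = x) (hq : q.val = x + 1) (ψ : Chain n N) :
    bond lam θ N x ψ = 0 ↔ ∀ σ : Fin N → Fin (n + 1),
      (σ p = σ q → σ p ≠ 0 → ψ σ = 0) ∧
      (σ p ≠ σ q → ψ σ = swapRatio lam θ (σ p) (σ q) * ψ (σ ∘ Equiv.swap p q)) := by
  have h0 (i j) : (swapWeight lam i j : ℂ) ≠ 0 := by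
    have := hlam i
    have := hlam j
    have : 0 < swapWeight lam i j := by unfold swapWeight; positivity
    exact_mod_cast this.ne'
  constructor
  · intro H σ
    have := congrArg (fun v : Chain n N => v σ) H
    simp only [bond_apply θ hlam h hp hq, PiLp.zero_apply] at this
    refine ⟨fun h1 h2 => by simpa [h1, h1 ▸ h2] using this, fun h1 => ?_⟩
    rw [if_neg h1] at this
    exact sub_eq_zero.1 ((mul_eq_zero.1 this).resolve_left (h0 _ _))
  · intro H
    ext σ
    rw [bond_apply θ hlam h hp hq, PiLp.zero_apply]
    split_ifs with h1 h2
    · rfl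
    · exact (H σ).1 h1 h2
    · rw [← (H σ).2 h1, sub_self, mul_zero]

end GroundSpace

/-! ### From neighbour exchanges to arbitrary rearrangements. -/

section Rearrangement

variable {N : ℕ}

/-- The sites in `[a, b)` with a given value. -/
def valueCount (a b : ℕ) (σ : Fin N → Fin (n + 1)) (i : Fin (n + 1)) : ℕ :=
  #{x : Fin N | (a ≤ x.val ∧ x.val < b) ∧ σ x = i}

/-- Two configurations that agree up to a permutation of the sites in `[a, b)`. -/
def IsRearr (a b : ℕ) (σ τ : Fin N → Fin (n + 1)) : Prop :=
  (∀ x : Fin N, ¬ (a ≤ x.val ∧ x.val < b) → σ x = τ x) ∧ valueCount a b σ = valueCount a b τ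

lemma IsRearr.refl (a b : ℕ) (σ : Fin N → Fin (n + 1)) : IsRearr a b σ σ := ⟨fun _ _ => rfl, rfl⟩

lemma IsRearr.symm {a b : ℕ} {σ τ : Fin N → Fin (n + 1)} (h : IsRearr a b σ τ) :
    IsRearr a b τ σ := ⟨fun x hx => (h.1 x hx).symm, h.2.symm⟩

lemma IsRearr.trans {a b : ℕ} {σ τ υ : Fin N → Fin (n + 1)} (h : IsRearr a b σ τ)
    (h' : IsRearr a b τ υ) : IsRearr a b σ υ :=
  ⟨fun x hx => (h.1 x hx).trans (h'.1 x hx), h.2.trans h'.2⟩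

lemma isRearr_comp_swap {a b : ℕ} (σ : Fin N → Fin (n + 1)) {p q : Fin N}
    (hp : a ≤ p.val ∧ p.val < b) (hq : a ≤ q.val ∧ q.val < b) :
    IsRearr a b (σ ∘ Equiv.swap p q) σ := by
  have hs (x : Fin N) : (a ≤ (Equiv.swap p q x).val ∧ (Equiv.swap p q x).val < b) ↔
      (a ≤ x.val ∧ x.val < b) := by
    rw [Equiv.swap_apply_def]
    split_ifs with h1 h2
    · subst h1; tauto
    · subst h2; tauto
    · rfl
  refine ⟨fun x hx => ?_, ?_⟩
  · rw [Function.comp_apply, Equiv.swap_apply_of_ne_of_ne]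
    · rintro rfl; exact hx hp
    · rintro rfl; exact hx hq
  · funext i
    refine card_bij (fun x _ => Equiv.swap p q x) ?_ ?_ ?_
    · intro x hx
      simpa [hs] using hx
    · intro x _ y _ hxy
      exact (Equiv.swap p q).injective hxy
    · intro x hx
      refine ⟨Equiv.swap p q x, ?_, by simp⟩
      simp only [mem_filter, mem_univ, true_and, hs] at hx ⊢
      simpa using hx

variable {α : Type*}

/-- Invariance under the exchange of neighbouring sites in `[a, b)`. -/
def SwapInvariant (a b : ℕ) (f : (Fin N → Fin (n + 1)) → α) : Prop :=
  ∀ p q : Fin N, a ≤ p.val → q.val = p.val + 1 → q.val < b →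
    ∀ σ, f (σ ∘ Equiv.swap p q) = f σ

/-- Induction on the distance: with `r` the left neighbour of `q`, the exchange of `p` and `q` is
that of `p` and `r` conjugated by that of `r` and `q`. -/
lemma SwapInvariant.comp_swap {a b : ℕ} {f : (Fin N → Fin (n + 1)) → α}
    (hf : SwapInvariant a b f) {p q : Fin N} (hp : a ≤ p.val) (hpq : p < q) (hq : q.val < b)
    (σ : Fin N → Fin (n + 1)) : f (σ ∘ Equiv.swap p q) = f σ := by
  obtain ⟨d, hd⟩ : ∃ d, q.val = p.val + 1 + d := ⟨q.val - (p.val + 1), by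
    have := Fin.lt_def.1 hpq; omega⟩
  clear hpq
  induction d generalizing q σ with
  | zero => exact hf p q hp (by omega) hq σ
  | succ d ih =>
    have hr : p.val + 1 + d < N := by have := q.isLt; omega
    set r : Fin N := ⟨p.val + 1 + d, hr⟩ with hrdef
    have hrv : r.val = p.val + 1 + d := rfl
    have e : Equiv.swap p q = Equiv.swap r q * Equiv.swap p r * Equiv.swap r q := by
      rw [Equiv.swap_mul_swap_mul_swap (by simp [Fin.ext_iff]; omega)
        (by simp [Fin.ext_iff]; omega), Equiv.swap_comm]
    have e2 : σ ∘ Equiv.swap p q =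
        ((σ ∘ Equiv.swap r q) ∘ Equiv.swap p r) ∘ Equiv.swap r q := by
      rw [e]; rfl
    rw [e2, hf r q (by omega) (by omega) hq, ih (by omega) _ hrv, hf r q (by omega) (by omega) hq]

lemma SwapInvariant.comp_swap' {a b : ℕ} {f : (Fin N → Fin (n + 1)) → α}
    (hf : SwapInvariant a b f) {p q : Fin N} (hp : a ≤ p.val ∧ p.val < b)
    (hq : a ≤ q.val ∧ q.val < b) (σ : Fin N → Fin (n + 1)) :
    f (σ ∘ Equiv.swap p q) = f σ := by
  rcases lt_trichotomy p q with h | h | h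
  · exact hf.comp_swap hp.1 h hq.2 σ
  · subst h; simp
  · rw [Equiv.swap_comm]; exact hf.comp_swap hq.1 h hp.2 σ

/-- Induction on the number of disagreements: a suitable exchange repairs one site and spoils none.
-/
lemma SwapInvariant.eq_of_isRearr {a b : ℕ} {f : (Fin N → Fin (n + 1)) → α}
    (hf : SwapInvariant a b f) {σ τ : Fin N → Fin (n + 1)} (h : IsRearr a b σ τ) :
    f σ = f τ := by
  induction hd : #{x : Fin N | σ x ≠ τ x} using Nat.strong_induction_on generalizing σ with
  | _ d ih =>
    by_cases hne : σ = τ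
    · rw [hne]
    obtain ⟨x, hx⟩ := Function.ne_iff.1 hne
    have hxI : a ≤ x.val ∧ x.val < b := by
      by_contra hc; exact hx (h.1 x hc)
    -- By equality of counts `σ` has the value needed at `x` at some site where `τ` does not. That
    -- site is itself a disagreement, so exchanging it with `x` creates no new one.
    obtain ⟨y, hyI, hy1, hy2⟩ : ∃ y : Fin N, (a ≤ y.val ∧ y.val < b) ∧ σ y = τ x ∧ τ y ≠ τ x := by
      by_contra! hc
      have hsub : ({y : Fin N | (a ≤ y.val ∧ y.val < b) ∧ σ y = τ x} : Finset (Fin N)) ⊂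
          ({y : Fin N | (a ≤ y.val ∧ y.val < b) ∧ τ y = τ x} : Finset (Fin N)) := by
        rw [ssubset_iff_of_subset]
        · exact ⟨x, by simp [hxI], by simp [hxI, hx]⟩
        · intro y hy
          simp only [mem_filter, mem_univ, true_and] at hy ⊢
          exact ⟨hy.1, hc y hy.1 hy.2⟩
      exact (card_lt_card hsub).ne (congrFun h.2 (τ x))
    have hlt : #{z : Fin N | (σ ∘ Equiv.swap x y) z ≠ τ z} < d := by
      rw [← hd]
      apply card_lt_card
      rw [ssubset_iff_of_subset]
      · exact ⟨x, by simp [hx], by simp [hy1]⟩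
      · intro z hz
        simp only [mem_filter, mem_univ, true_and, Function.comp_apply] at hz ⊢
        by_cases hzx : z = x
        · rw [hzx]; exact hx
        by_cases hzy : z = y
        · rw [hzy, hy1]; exact hy2.symm
        · rwa [Equiv.swap_apply_of_ne_of_ne hzx hzy] at hz
    rw [← hf.comp_swap' hxI hyI σ]
    exact ih _ hlt ((isRearr_comp_swap σ hxI hyI).trans h) rfl

end Rearrangement

/-! ### An explicit solution of the exchange relations. -/

section Gauge

variable (lam : Fin (n + 1) → ℝ) (θ : Fin (n + 1) → Fin (n + 1) → ℝ) {N : ℕ}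

/-- The modulus of the ground state amplitudes. -/
noncomputable def gaugeWeight (σ : Fin N → Fin (n + 1)) : ℝ := ∏ x : Fin N, lam (σ x) ^ x.val

/-- A nowhere vanishing function on configurations that solves the ground state equations for
neighbouring sites with different values. -/
noncomputable def gauge (σ : Fin N → Fin (n + 1)) : ℂ :=
  gaugeWeight lam σ *
    ∏ r : Fin N × Fin N, if r.1 < r.2 then pairPhase θ (σ r.1) (σ r.2) else 1

variable {lam}

lemma gaugeWeight_pos (hlam : ∀ i, 0 < lam i) (σ : Fin N → Fin (n + 1)) :
    0 < gaugeWeight lam σ := prod_pos fun _ _ => pow_pos (hlam _) _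

lemma norm_gauge (hlam : ∀ i, 0 < lam i) (σ : Fin N → Fin (n + 1)) :
    ‖gauge lam θ σ‖ = gaugeWeight lam σ := by
  rw [gauge, norm_mul, norm_prod, prod_eq_one, mul_one, Complex.norm_real, Real.norm_eq_abs,
    abs_of_pos (gaugeWeight_pos hlam σ)]
  intro r _
  split_ifs <;> simp [norm_pairPhase]

lemma gauge_ne_zero (hlam : ∀ i, 0 < lam i) (σ : Fin N → Fin (n + 1)) : gauge lam θ σ ≠ 0 := by
  rw [← norm_pos_iff, norm_gauge θ hlam]; exact gaugeWeight_pos hlam σ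

/-- Arbitrary distinct sites are allowed: neighbours serve the gauge relation, distant sites the
decay estimates. -/
lemma gaugeWeight_comp_swap {p q : Fin N} (hpq : p ≠ q) (σ : Fin N → Fin (n + 1)) :
    gaugeWeight lam σ * (lam (σ p) ^ q.val * lam (σ q) ^ p.val) =
      gaugeWeight lam (σ ∘ Equiv.swap p q) * (lam (σ p) ^ p.val * lam (σ q) ^ q.val) := by
  have key (τ : Fin N → Fin (n + 1)) : gaugeWeight lam τ =
      (lam (τ p) ^ p.val * lam (τ q) ^ q.val) *
        ∏ x ∈ univ \ {p, q}, lam (τ x) ^ x.val := by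
    rw [gaugeWeight, ← prod_sdiff (subset_univ {p, q}), prod_pair hpq, mul_comm]
  have e : ∏ x ∈ univ \ {p, q}, lam ((σ ∘ Equiv.swap p q) x) ^ x.val =
      ∏ x ∈ univ \ {p, q}, lam (σ x) ^ x.val := by
    refine prod_congr rfl fun x hx => ?_
    simp only [mem_sdiff, mem_univ, true_and, mem_insert, mem_singleton, not_or] at hx
    rw [Function.comp_apply, Equiv.swap_apply_of_ne_of_ne hx.1 hx.2]
  rw [key σ, key (σ ∘ Equiv.swap p q), e]
  simp only [Function.comp_apply, Equiv.swap_apply_left, Equiv.swap_apply_right]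
  ring

/-- Exchanging neighbours changes the modulus by a ratio of weights and reverses the order of one
pair of sites only; the phases of all other pairs are merely permuted. -/
lemma gauge_eq (hlam : ∀ i, 0 < lam i) {p q : Fin N} (hq : q.val = p.val + 1)
    (σ : Fin N → Fin (n + 1)) :
    gauge lam θ σ = swapRatio lam θ (σ p) (σ q) * gauge lam θ (σ ∘ Equiv.swap p q) := by
  have hpq : p ≠ q := by rintro rfl; omega
  have hlt : p < q := by rw [Fin.lt_def]; omega
  have hw : (gaugeWeight lam σ : ℂ) =
      (lam (σ q) : ℂ) / lam (σ p) * gaugeWeight lam (σ ∘ Equiv.swap p q) := by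
    have h := gaugeWeight_comp_swap (lam := lam) hpq σ
    have h1 := hlam (σ p)
    have h2 := hlam (σ q)
    norm_cast
    rw [hq] at h
    field_simp
    have h3 : 0 < lam (σ p) ^ p.val * lam (σ q) ^ p.val := by positivity
    apply mul_left_cancel₀ h3.ne'
    rw [pow_succ, pow_succ] at h
    linarith
  have key (τ : Fin N → Fin (n + 1)) :
      (∏ r : Fin N × Fin N, if r.1 < r.2 then pairPhase θ (τ r.1) (τ r.2) else 1) =
      pairPhase θ (τ p) (τ q) *
        ∏ r ∈ univ \ {(p, q), (q, p)},
          if r.1 < r.2 then pairPhase θ (τ r.1) (τ r.2) else 1 := by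
    rw [← prod_sdiff (subset_univ {(p, q), (q, p)}), prod_pair (by simp [hpq]), mul_comm]
    simp [hlt, hlt.not_gt]
  have e : (∏ r ∈ univ \ {(p, q), (q, p)}, if r.1 < r.2 then
        pairPhase θ ((σ ∘ Equiv.swap p q) r.1) ((σ ∘ Equiv.swap p q) r.2) else 1) =
      ∏ r ∈ univ \ {(p, q), (q, p)},
        if r.1 < r.2 then pairPhase θ (σ r.1) (σ r.2) else 1 := by
    have hmem (r : Fin N × Fin N) : r ∈ (univ \ {(p, q), (q, p)} : Finset (Fin N × Fin N)) ↔
        ¬ (r.1 = p ∧ r.2 = q) ∧ ¬ (r.1 = q ∧ r.2 = p) := by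
      simp [Prod.ext_iff, not_or]
    refine prod_bij' (fun r _ => (Equiv.swap p q r.1, Equiv.swap p q r.2))
      (fun r _ => (Equiv.swap p q r.1, Equiv.swap p q r.2)) ?_ ?_ ?_ ?_ ?_
    · rintro ⟨r, s⟩ h
      rw [hmem] at h ⊢
      simp only [Equiv.swap_apply_eq_iff, Equiv.swap_apply_left, Equiv.swap_apply_right]
      tauto
    · rintro ⟨r, s⟩ h
      rw [hmem] at h ⊢
      simp only [Equiv.swap_apply_eq_iff, Equiv.swap_apply_left, Equiv.swap_apply_right]
      tauto
    · intro r _; simp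
    · intro r _; simp
    · rintro ⟨r, s⟩ h
      rw [hmem] at h
      have hiff : Equiv.swap p q r < Equiv.swap p q s ↔ r < s := by
        simp only [Fin.lt_def]
        simp only [Equiv.swap_apply_def]
        simp only [Fin.ext_iff] at h
        split_ifs with h1 h2 h3 h4 h5 h6 <;>
          simp only [Fin.ext_iff] at * <;> omega
      simp only [Function.comp_apply, hiff]
  have u1 := pairPhase_ne_zero θ (σ p) (σ q)
  have u2 := pairPhase_ne_zero θ (σ q) (σ p)
  rw [gauge, gauge, key σ, key (σ ∘ Equiv.swap p q), e, hw, swapRatio]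
  simp only [Function.comp_apply, Equiv.swap_apply_left, Equiv.swap_apply_right]
  field_simp

end Gauge

/-! ### Description of ground states and comparison of their amplitudes. -/

section Structure

variable {lam : Fin (n + 1) → ℝ} (θ : Fin (n + 1) → Fin (n + 1) → ℝ) {N : ℕ}

/-- Ground states on `[a, b)` are, relative to the gauge, permutation invariant functions that
vanish where a particle species occurs twice. -/
lemma mem_groundSpace_iff (hlam : ∀ i, 0 < lam i) {a b : ℕ} (hb : b ≤ N) {ψ : Chain n N} :
    ψ ∈ groundSpace lam θ N a b ↔
      SwapInvariant a b (fun σ => ψ σ / gauge lam θ σ) ∧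
      ∀ p q : Fin N, (a ≤ p.val ∧ p.val < b) → (a ≤ q.val ∧ q.val < b) → p ≠ q →
        ∀ σ : Fin N → Fin (n + 1), σ p = σ q → σ p ≠ 0 → ψ σ = 0 := by
  have hg := gauge_ne_zero (N := N) θ hlam
  constructor
  · intro h
    have hinv : SwapInvariant a b (fun σ => ψ σ / gauge lam θ σ) := by
      intro p q hp hq hqb σ
      have h0 := (bond_eq_zero_iff θ hlam (by omega) rfl hq ψ).1
        (h p.val hp (by omega)) σ
      by_cases he : σ p = σ q
      · have : σ ∘ Equiv.swap p q = σ := by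
          funext z
          simp only [Function.comp_apply, Equiv.swap_apply_def]
          split_ifs with h1 h2
          · rw [h1, he]
          · rw [h2, he]
          · rfl
        rw [this]
      · have h1 := h0.2 he
        have h2 := gauge_eq θ hlam hq σ
        have h3 := swapRatio_ne_zero θ hlam (σ p) (σ q)
        have h4 := hg (σ ∘ Equiv.swap p q)
        simp only
        rw [h1, h2]
        field_simp
    refine ⟨hinv, ?_⟩
    -- Invariance brings the second particle next to the first, where a single bond forces the
    -- amplitude to vanish.
    have key (p q : Fin N) (hp : a ≤ p.val) (hlt : p < q) (hq : q.val < b)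
        (σ : Fin N → Fin (n + 1)) (h1 : σ p = σ q) (h2 : σ p ≠ 0) : ψ σ = 0 := by
      have hlt' := Fin.lt_def.1 hlt
      set r : Fin N := ⟨p.val + 1, by omega⟩ with hr
      have hpr : p ≠ r := by simp [hr, Fin.ext_iff]
      have e := hinv.comp_swap' (p := r) (q := q) ⟨by simp [hr]; omega, by simp [hr]; omega⟩
        ⟨by omega, hq⟩ σ
      have h0 := (bond_eq_zero_iff θ hlam (by omega) rfl (q := r) rfl ψ).1
        (h p.val hp (by omega)) (σ ∘ Equiv.swap r q)
      have h3 : (σ ∘ Equiv.swap r q) p = σ p := by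
        rw [Function.comp_apply, Equiv.swap_apply_of_ne_of_ne hpr hlt.ne]
      have h4 : (σ ∘ Equiv.swap r q) r = σ q := by simp
      rw [h3, h4] at h0
      rw [h0.1 h1 h2, zero_div, eq_comm, div_eq_zero_iff] at e
      exact e.resolve_right (hg σ)
    intro p q hp hq hpq σ h1 h2
    rcases lt_or_gt_of_ne hpq with hlt | hlt
    · exact key p q hp.1 hlt hq.2 σ h1 h2
    · exact key q p hq.1 hlt hp.2 σ h1.symm (h1 ▸ h2)
  · rintro ⟨hinv, hz⟩ x ha hx
    obtain ⟨p, q, hp, hq, hpq⟩ := exists_sites (N := N) (x := x) (by omega)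
    rw [bond_eq_zero_iff θ hlam (by omega) hp hq]
    intro σ
    refine ⟨fun h1 h2 => hz p q (by omega) (by omega) hpq σ h1 h2, fun h1 => ?_⟩
    have e := hinv p q (by omega) (by omega) (by omega) σ
    simp only at e
    have h2 := gauge_eq θ hlam (p := p) (q := q) (by omega) σ
    have h4 := hg (σ ∘ Equiv.swap p q)
    have h3 := swapRatio_ne_zero θ hlam (σ p) (σ q)
    rw [h2, div_eq_div_iff h4 (mul_ne_zero h3 h4)] at e
    apply mul_right_cancel₀ h4
    rw [← e]
    ring

/-- Both amplitudes share the same ratio to the gauge, and a vacuum site contributes 1 to the gauge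
weight because `lam 0 = 1`; only the position of the moved particle matters. -/
lemma norm_sq_comp_swap (hlam : ∀ i, 0 < lam i) (hlam0 : lam 0 = 1) {a b : ℕ} (hb : b ≤ N)
    {ψ : Chain n N} (hψ : ψ ∈ groundSpace lam θ N a b) {p q : Fin N}
    (hp : a ≤ p.val ∧ p.val < b) (hq : a ≤ q.val ∧ q.val < b) (hpq : p ≠ q)
    {σ : Fin N → Fin (n + 1)} (h0 : σ q = 0) :
    ‖ψ σ‖ = lam (σ p) ^ p.val / lam (σ p) ^ q.val * ‖ψ (σ ∘ Equiv.swap p q)‖ := by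
  have h := ((mem_groundSpace_iff θ hlam hb).1 hψ).1.comp_swap' hp hq σ
  have h1 := congrArg norm h
  simp only [norm_div, norm_gauge θ hlam] at h1
  have h2 := gaugeWeight_comp_swap (lam := lam) hpq σ
  rw [h0, hlam0, one_pow, one_pow, mul_one, mul_one] at h2
  have g1 := gaugeWeight_pos hlam σ
  have g2 := gaugeWeight_pos hlam (σ ∘ Equiv.swap p q)
  have l := hlam (σ p)
  rw [div_eq_div_iff g2.ne' g1.ne'] at h1
  apply mul_right_cancel₀ g2.ne'
  rw [← h1]
  field_simp
  rw [mul_assoc, h2]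
  ring

/-- The weight of the configurations with a particle `i` at `x` in a ground state, compared
with moving the particle to an empty site in `Y`. -/
lemma sum_norm_sq_le_of_mem_groundSpace (hlam : ∀ i, 0 < lam i) (hlam0 : lam 0 = 1)
    {a b : ℕ} (hb : b ≤ N)
    {ψ : Chain n N} (hψ : ψ ∈ groundSpace lam θ N a b) {p : Fin N}
    (hp : a ≤ p.val ∧ p.val < b) {i : Fin (n + 1)} (hi : i ≠ 0) (Y : Finset (Fin N))
    (hY : #Y = n) (hYI : ∀ y ∈ Y, (a ≤ y.val ∧ y.val < b) ∧ y ≠ p) {ε : ℝ}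
    (hYε : ∀ y ∈ Y, lam i ^ p.val ≤ ε * lam i ^ y.val) :
    ∑ σ with σ p = i, ‖ψ σ‖ ^ 2 ≤ n * ε ^ 2 * ‖ψ‖ ^ 2 := by
  have hrep := ((mem_groundSpace_iff θ hlam hb).1 hψ).2
  -- Otherwise the `n + 1` sites of `Y` and `p` would carry only `n` nonvacuum species, so one of
  -- them would repeat and the amplitude would vanish.
  have hpig (σ : Fin N → Fin (n + 1)) (hσ : σ p = i) (hne : ψ σ ≠ 0) : ∃ y ∈ Y, σ y = 0 := by
    by_contra! hc
    have hmaps : ∀ y ∈ insert p Y, σ y ∈ (univ.erase 0 : Finset (Fin (n + 1))) := by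
      intro y hy
      rcases mem_insert.1 hy with rfl | hy
      · simp [hσ, hi]
      · simp [hc y hy]
    have hcard : #(univ.erase 0 : Finset (Fin (n + 1))) < #(insert p Y) := by
      rw [card_insert_of_notMem (fun h => (hYI p h).2 rfl), hY]
      simp
    obtain ⟨y, hy, z, hz, hyz, he⟩ := exists_ne_map_eq_of_card_lt_of_maps_to hcard hmaps
    have hI (w) (hw : w ∈ insert p Y) : a ≤ w.val ∧ w.val < b := by
      rcases mem_insert.1 hw with rfl | hw
      · exact hp
      · exact (hYI w hw).1
    exact hne (hrep y z (hI y hy) (hI z hz) hyz σ he (by simpa using hmaps y hy))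
  have hnorm : ‖ψ‖ ^ 2 = ∑ σ, ‖ψ σ‖ ^ 2 := EuclideanSpace.norm_sq_eq ψ
  calc ∑ σ with σ p = i, ‖ψ σ‖ ^ 2
      ≤ ∑ σ with σ p = i, ∑ y ∈ Y, ε ^ 2 * ‖ψ (σ ∘ Equiv.swap p y)‖ ^ 2 := by
        refine sum_le_sum fun σ hσ => ?_
        have hσ' : σ p = i := by simpa using hσ
        by_cases hne : ψ σ = 0
        · rw [hne, norm_zero, zero_pow two_ne_zero]
          positivity
        obtain ⟨y, hy, hy0⟩ := hpig σ hσ' hne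
        refine le_trans ?_ (single_le_sum (f := fun y => ε ^ 2 * ‖ψ (σ ∘ Equiv.swap p y)‖ ^ 2)
          (fun _ _ => by positivity) hy)
        have h1 := norm_sq_comp_swap θ hlam hlam0 hb hψ hp (hYI y hy).1 (hYI y hy).2.symm hy0
        rw [hσ'] at h1
        have hl := hlam i
        have h2 : lam i ^ p.val / lam i ^ y.val ≤ ε := by
          rw [div_le_iff₀ (by positivity)]
          exact hYε y hy
        simp only
        rw [← mul_pow]
        apply pow_le_pow_left₀ (norm_nonneg _)
        rw [h1]
        exact mul_le_mul_of_nonneg_right h2 (norm_nonneg _)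
    _ ≤ ∑ σ, ∑ y ∈ Y, ε ^ 2 * ‖ψ (σ ∘ Equiv.swap p y)‖ ^ 2 :=
        sum_le_sum_of_subset_of_nonneg (filter_subset _ _) fun _ _ _ =>
          sum_nonneg fun _ _ => by positivity
    -- For fixed `y` the exchange of `p` and `y` permutes the configurations.
    _ = ∑ y ∈ Y, ε ^ 2 * ‖ψ‖ ^ 2 := by
        rw [sum_comm]
        refine sum_congr rfl fun y _ => ?_
        rw [← mul_sum, sum_comp_swap p y (fun σ => ‖ψ σ‖ ^ 2), hnorm]
    _ = n * ε ^ 2 * ‖ψ‖ ^ 2 := by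
        rw [sum_const, hY, nsmul_eq_mul, mul_assoc]

end Structure

/-! ### Exponentially small weight of misplaced particles. -/

section Decay

variable {lam : Fin (n + 1) → ℝ} (θ : Fin (n + 1) → Fin (n + 1) → ℝ) {N : ℕ}

lemma sum_pow_le_of_injOn {ι : Type*} {q : ℝ} (hq0 : 0 ≤ q) (hq1 : q < 1)
    (s : Finset ι) (e : ι → ℕ) (he : Set.InjOn e s) : ∑ x ∈ s, q ^ e x ≤ (1 - q)⁻¹ := by
  classical
  rw [← sum_image (f := fun j => q ^ j) he]
  exact sum_le_hasSum _ (fun _ _ => by positivity) (hasSum_geometric_of_lt_one hq0 hq1)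

/-- A particle whose weight exceeds one somewhere to the left of the cut. -/
def HasRightMover (lam : Fin (n + 1) → ℝ) (c : ℕ) (σ : Fin N → Fin (n + 1)) : Prop :=
  ∃ x : Fin N, x.val < c ∧ 1 < lam (σ x)

/-- A particle whose weight is below one somewhere to the right of the cut. -/
def HasLeftMover (lam : Fin (n + 1) → ℝ) (c b : ℕ) (σ : Fin N → Fin (n + 1)) : Prop :=
  ∃ x : Fin N, (c ≤ x.val ∧ x.val < b) ∧ lam (σ x) < 1

/-- The bound for the weight of misplaced particles in a ground state. -/
noncomputable def misplacedBound (n : ℕ) (q : ℝ) (m : ℕ) : ℝ := n ^ 2 * q ^ m * (1 - q)⁻¹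

-- A union bound over sites and species. Injectivity of the exponent on `s` makes the sum over sites
-- at most a geometric series.
open Classical in
lemma sum_norm_sq_le_of_sites {ψ : Chain n N} {q : ℝ} (hq0 : 0 < q) (hq1 : q < 1) (m : ℕ)
    (s : Finset (Fin N)) (t : Finset (Fin (n + 1))) (ht : (0 : Fin (n + 1)) ∉ t)
    (e : Fin N → ℕ) (he : Set.InjOn e s)
    (h : ∀ x ∈ s, ∀ i ∈ t, ∑ σ with σ x = i, ‖ψ σ‖ ^ 2 ≤ n * (q ^ m * q ^ e x) ^ 2 * ‖ψ‖ ^ 2) :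
    ∑ σ with ∃ x ∈ s, σ x ∈ t, ‖ψ σ‖ ^ 2 ≤ misplacedBound n q m * ‖ψ‖ ^ 2 := by
  have htn : (#t : ℝ) ≤ n := by
    have : #t ≤ #(univ.erase (0 : Fin (n + 1))) :=
      card_le_card fun i hi => by
        simp only [mem_erase, mem_univ, and_true]; rintro rfl; exact ht hi
    rw [card_erase_of_mem (mem_univ _), card_univ, Fintype.card_fin, Nat.add_sub_cancel] at this
    exact_mod_cast this
  calc ∑ σ with ∃ x ∈ s, σ x ∈ t, ‖ψ σ‖ ^ 2
      ≤ ∑ σ, ∑ x ∈ s, ∑ i ∈ t, if σ x = i then ‖ψ σ‖ ^ 2 else 0 := by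
        rw [sum_filter]
        refine sum_le_sum fun σ _ => ?_
        have hnn : ∀ x ∈ s, 0 ≤ ∑ i ∈ t, if σ x = i then ‖ψ σ‖ ^ 2 else 0 :=
          fun x _ => sum_nonneg fun i _ => by split_ifs <;> positivity
        split_ifs with hσ
        · obtain ⟨x, hx, hxt⟩ := hσ
          refine le_trans ?_ (single_le_sum hnn hx)
          simp [hxt]
        · exact sum_nonneg hnn
    _ = ∑ x ∈ s, ∑ i ∈ t, ∑ σ with σ x = i, ‖ψ σ‖ ^ 2 := by
        rw [sum_comm]
        refine sum_congr rfl fun x _ => ?_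
        rw [sum_comm]
        exact sum_congr rfl fun i _ => by rw [sum_filter]
    -- The square is given away, since its base is at most 1.
    _ ≤ ∑ x ∈ s, ∑ i ∈ t, n * (q ^ m * q ^ e x) * ‖ψ‖ ^ 2 := by
        refine sum_le_sum fun x hx => sum_le_sum fun i hi => (h x hx i hi).trans ?_
        have h0 : 0 ≤ q ^ m * q ^ e x := by positivity
        have h1 : q ^ m * q ^ e x ≤ 1 :=
          mul_le_one₀ (pow_le_one₀ hq0.le hq1.le) (by positivity) (pow_le_one₀ hq0.le hq1.le)
        gcongr
        nlinarith
    _ = #t * (n * q ^ m * ‖ψ‖ ^ 2) * ∑ x ∈ s, q ^ e x := by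
        simp only [sum_const, nsmul_eq_mul, mul_sum]
        exact sum_congr rfl fun x _ => by ring
    _ ≤ n * (n * q ^ m * ‖ψ‖ ^ 2) * (1 - q)⁻¹ := by
        gcongr
        exact sum_pow_le_of_injOn hq0.le hq1 s e he
    _ = misplacedBound n q m * ‖ψ‖ ^ 2 := by
        rw [misplacedBound]; ring

-- The comparison sites are the first `n` sites of the interval. A site `x ≥ c` is more than `m + (x
-- - c)` steps to their right, and each step costs a factor at most `q`.
open Classical in
lemma sum_norm_sq_hasLeftMover_le (hlam : ∀ i, 0 < lam i) (hlam0 : lam 0 = 1) {q : ℝ}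
    (hq0 : 0 < q) (hq1 : q < 1) (hsp : ∀ i, i ≠ 0 → lam i ≤ q ∨ 1 ≤ q * lam i)
    {a b c m : ℕ} (hb : b ≤ N) (hc : a + n + m ≤ c)
    {ψ : Chain n N} (hψ : ψ ∈ groundSpace lam θ N a b) :
    ∑ σ with HasLeftMover lam c b σ, ‖ψ σ‖ ^ 2 ≤ misplacedBound n q m * ‖ψ‖ ^ 2 := by
  have h := sum_norm_sq_le_of_sites (ψ := ψ) hq0 hq1 m
    {x : Fin N | c ≤ x.val ∧ x.val < b} {i : Fin (n + 1) | lam i < 1} (by simp [hlam0])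
    (fun x => x.val - c)
    (by
      intro x hx y hy hxy
      simp only [coe_filter, mem_univ, true_and, Set.mem_ofPred_eq] at hx hy hxy
      exact Fin.ext (by omega)) ?_
  · refine le_trans (le_of_eq (sum_congr ?_ fun _ _ => rfl)) h
    ext σ
    rw [mem_filter, mem_filter]
    simp [HasLeftMover]
  · intro x hx i hi
    simp only [mem_filter, mem_univ, true_and] at hx hi
    have hi0 : i ≠ 0 := by rintro rfl; exact absurd hlam0 hi.ne
    have hli := hlam i
    have hiq : lam i ≤ q := by
      refine (hsp i hi0).resolve_right fun h1 => ?_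
      nlinarith
    have hxN := x.isLt
    obtain ⟨f, hf⟩ : ∃ f : Fin n ↪ Fin N, ∀ j, (f j).val = a + j.val :=
      ⟨⟨fun j => ⟨a + j.val, by have := j.isLt; omega⟩, by
        intro j k hjk
        simp only [Fin.mk.injEq] at hjk
        exact Fin.ext (by omega)⟩, fun _ => rfl⟩
    refine sum_norm_sq_le_of_mem_groundSpace θ hlam hlam0 hb hψ ⟨by omega, hx.2⟩ hi0
      (univ.map f) (by simp) ?_ ?_
    · intro y hy
      obtain ⟨j, -, rfl⟩ := mem_map.1 hy
      have := j.isLt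
      have := hf j
      exact ⟨by omega, by simp only [ne_eq, Fin.ext_iff]; omega⟩
    · intro y hy
      obtain ⟨j, -, rfl⟩ := mem_map.1 hy
      have := j.isLt
      rw [hf j, ← pow_add]
      have e : x.val = (x.val - (a + j.val)) + (a + j.val) := by omega
      rw [e, pow_add]
      refine mul_le_mul_of_nonneg_right ?_ (by positivity)
      calc lam i ^ (x.val - (a + j.val)) ≤ q ^ (x.val - (a + j.val)) :=
            pow_le_pow_left₀ hli.le hiq _
        _ ≤ _ := pow_le_pow_of_le_one hq0.le hq1.le (by omega)

-- The mirror image, with the last `n` sites of the interval as comparison sites.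
open Classical in
lemma sum_norm_sq_hasRightMover_le (hlam : ∀ i, 0 < lam i) (hlam0 : lam 0 = 1) {q : ℝ}
    (hq0 : 0 < q) (hq1 : q < 1) (hsp : ∀ i, i ≠ 0 → lam i ≤ q ∨ 1 ≤ q * lam i)
    {b c m : ℕ} (hb : b ≤ N) (hc : c + n + m ≤ b)
    {ψ : Chain n N} (hψ : ψ ∈ groundSpace lam θ N 0 b) :
    ∑ σ with HasRightMover lam c σ, ‖ψ σ‖ ^ 2 ≤ misplacedBound n q m * ‖ψ‖ ^ 2 := by
  have h := sum_norm_sq_le_of_sites (ψ := ψ) hq0 hq1 m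
    {x : Fin N | x.val < c} {i : Fin (n + 1) | 1 < lam i} (by simp [hlam0])
    (fun x => c - x.val)
    (by
      intro x hx y hy hxy
      simp only [coe_filter, mem_univ, true_and, Set.mem_ofPred_eq] at hx hy hxy
      exact Fin.ext (by omega)) ?_
  · refine le_trans (le_of_eq (sum_congr ?_ fun _ _ => rfl)) h
    ext σ
    rw [mem_filter, mem_filter]
    simp [HasRightMover]
  · intro x hx i hi
    simp only [mem_filter, mem_univ, true_and] at hx hi
    have hi0 : i ≠ 0 := by rintro rfl; exact absurd hlam0 hi.ne'
    have hli := hlam i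
    have hiq : 1 ≤ q * lam i := (hsp i hi0).resolve_left fun h1 => by linarith
    obtain ⟨f, hf⟩ : ∃ f : Fin n ↪ Fin N, ∀ j, (f j).val = b - n + j.val :=
      ⟨⟨fun j => ⟨b - n + j.val, by have := j.isLt; omega⟩, by
        intro j k hjk
        simp only [Fin.mk.injEq] at hjk
        exact Fin.ext (by omega)⟩, fun _ => rfl⟩
    refine sum_norm_sq_le_of_mem_groundSpace θ hlam hlam0 hb hψ ⟨by omega, by omega⟩ hi0
      (univ.map f) (by simp) ?_ ?_
    · intro y hy
      obtain ⟨j, -, rfl⟩ := mem_map.1 hy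
      have := j.isLt
      have := hf j
      exact ⟨by omega, by simp only [ne_eq, Fin.ext_iff]; omega⟩
    · intro y hy
      obtain ⟨j, -, rfl⟩ := mem_map.1 hy
      have := j.isLt
      rw [hf j, ← pow_add]
      have e : b - n + j.val = (b - n + j.val - x.val) + x.val := by omega
      rw [e, pow_add (lam i), ← mul_assoc]
      refine le_mul_of_one_le_left (by positivity) ?_
      calc (1 : ℝ) ≤ (q * lam i) ^ (b - n + j.val - x.val) := one_le_pow₀ hiq
        _ = q ^ (b - n + j.val - x.val) * lam i ^ (b - n + j.val - x.val) := mul_pow _ _ _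
        _ ≤ _ := by
          refine mul_le_mul_of_nonneg_right ?_ (by positivity)
          exact pow_le_pow_of_le_one hq0.le hq1.le (by omega)

end Decay

/-! ### Gluing sorted ground states across a cut. -/

section Extension

variable {lam : Fin (n + 1) → ℝ} (θ : Fin (n + 1) → Fin (n + 1) → ℝ) {N : ℕ}

/-- All particles in `[0, k)` are on their side of the cut `c`. -/
def IsSorted (lam : Fin (n + 1) → ℝ) (c k : ℕ) (σ : Fin N → Fin (n + 1)) : Prop :=
  ∀ x : Fin N, (x.val < c → lam (σ x) ≤ 1) ∧ (c ≤ x.val → x.val < k → 1 ≤ lam (σ x))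

lemma isSorted_iff {c k : ℕ} (σ : Fin N → Fin (n + 1)) :
    IsSorted lam c k σ ↔ ¬ HasRightMover lam c σ ∧ ¬ HasLeftMover lam c k σ := by
  simp only [IsSorted, HasRightMover, HasLeftMover, not_exists, not_and, not_lt, forall_and]
  tauto

lemma valueCount_add {a b c : ℕ} (hab : a ≤ b) (hbc : b ≤ c) (σ : Fin N → Fin (n + 1))
    (i : Fin (n + 1)) : valueCount a b σ i + valueCount b c σ i = valueCount a c σ i := by
  unfold valueCount
  rw [← card_union_of_disjoint]
  · congr 1
    ext x
    simp only [mem_union, mem_filter, mem_univ, true_and]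
    constructor
    · rintro (h | h)
      · exact ⟨by omega, h.2⟩
      · exact ⟨by omega, h.2⟩
    · rintro ⟨h, h'⟩
      by_cases hx : x.val < b
      · exact Or.inl ⟨by omega, h'⟩
      · exact Or.inr ⟨by omega, h'⟩
  · rw [disjoint_left]
    intro x hx hy
    simp only [mem_filter, mem_univ, true_and] at hx hy
    omega

lemma sum_valueCount (a b : ℕ) (σ : Fin N → Fin (n + 1)) :
    ∑ i, valueCount a b σ i = #{x : Fin N | a ≤ x.val ∧ x.val < b} := by
  rw [card_eq_sum_card_fiberwise (f := σ) (t := univ) (fun _ _ => mem_coe.2 (mem_univ _))]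
  exact sum_congr rfl fun i _ => by rw [valueCount, filter_filter]

lemma valueCount_eq_zero {a b : ℕ} {σ : Fin N → Fin (n + 1)} {i : Fin (n + 1)}
    (h : ∀ x : Fin N, a ≤ x.val → x.val < b → σ x ≠ i) : valueCount a b σ i = 0 := by
  rw [valueCount, card_eq_zero, filter_eq_empty_iff]
  rintro x - ⟨⟨h1, h2⟩, h3⟩
  exact h x h1 h2 h3

/-- Sortedness puts every species with `λ < 1` entirely left of the cut and every species with `λ >
1` entirely right of it; the vacuum fills the remaining sites. -/
lemma valueCount_eq_of_isSorted (hlam1 : ∀ i, i ≠ 0 → lam i ≠ 1) {c k : ℕ}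
    (hck : c ≤ k) {σ τ : Fin N → Fin (n + 1)} (hσ : IsSorted lam c k σ)
    (hτ : IsSorted lam c k τ) (h : valueCount 0 k σ = valueCount 0 k τ) :
    valueCount 0 c σ = valueCount 0 c τ := by
  have hne (i : Fin (n + 1)) (hi : i ≠ 0) : valueCount 0 c σ i = valueCount 0 c τ i := by
    rcases lt_or_gt_of_ne (hlam1 i hi) with hl | hl
    · have e (υ : Fin N → Fin (n + 1)) (hυ : IsSorted lam c k υ) :
          valueCount 0 c υ i = valueCount 0 k υ i := by
        rw [← valueCount_add (Nat.zero_le c) hck, valueCount_eq_zero (a := c), add_zero]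
        intro x h1 h2 h3
        have := (hυ x).2 h1 h2
        rw [h3] at this
        linarith
      rw [e σ hσ, e τ hτ, h]
    · have e (υ : Fin N → Fin (n + 1)) (hυ : IsSorted lam c k υ) :
          valueCount 0 c υ i = 0 := by
        refine valueCount_eq_zero fun x _ h2 h3 => ?_
        have := (hυ x).1 h2
        rw [h3] at this
        linarith
      rw [e σ hσ, e τ hτ]
  funext i
  by_cases hi : i = 0
  · subst hi
    have h1 := (sum_valueCount 0 c σ).trans (sum_valueCount 0 c τ).symm
    rw [← add_sum_erase _ _ (mem_univ (0 : Fin (n + 1))),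
      ← add_sum_erase _ (valueCount 0 c τ) (mem_univ (0 : Fin (n + 1))),
      sum_congr rfl fun i hi => hne i (ne_of_mem_erase hi)] at h1
    exact Nat.add_right_cancel h1
  · exact hne i hi

/-- A ground state on both sides of a cut, all of whose particles are on their own side, is the
sorted part of a ground state of the whole interval. -/
lemma exists_extension (hlam : ∀ i, 0 < lam i) (hlam1 : ∀ i, i ≠ 0 → lam i ≠ 1) {c k : ℕ}
    (hck : c ≤ k) (hk : k ≤ N) {w : Chain n N} (h1 : w ∈ groundSpace lam θ N 0 c)
    (h2 : w ∈ groundSpace lam θ N c k) :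
    ∃ v ∈ groundSpace lam θ N 0 k, ∀ σ, IsSorted lam c k σ → v σ = w σ := by
  classical
  have hg := gauge_ne_zero (N := N) θ hlam
  obtain ⟨h1i, h1z⟩ := (mem_groundSpace_iff θ hlam (hck.trans hk)).1 h1
  obtain ⟨h2i, h2z⟩ := (mem_groundSpace_iff θ hlam hk).1 h2
  set f : (Fin N → Fin (n + 1)) → ℂ := fun σ => w σ / gauge lam θ σ with hf
  set P : (Fin N → Fin (n + 1)) → (Fin N → Fin (n + 1)) → Prop :=
    fun σ τ => IsSorted lam c k τ ∧ IsRearr 0 k τ σ with hP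
  -- The gauge ratio is read off from a chosen sorted rearrangement, and is 0 if there is none.
  -- Taking the predicate as argument makes the choice the same for all rearrangements of a
  -- configuration.
  let g : ((Fin N → Fin (n + 1)) → Prop) → ℂ := fun p => if h : ∃ τ, p τ then f h.choose else 0
  have hfeq {σ τ : Fin N → Fin (n + 1)} (hσ : IsSorted lam c k σ) (hτ : IsSorted lam c k τ)
      (h : IsRearr 0 k τ σ) : f τ = f σ := by
    have e1 := valueCount_eq_of_isSorted hlam1 hck hτ hσ h.2
    have e2 : valueCount c k τ = valueCount c k σ := by
      funext i
      have a1 := valueCount_add (Nat.zero_le c) hck τ i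
      have a2 := valueCount_add (Nat.zero_le c) hck σ i
      have a3 := congrFun e1 i
      have a4 := congrFun h.2 i
      omega
    -- A hybrid that differs from `τ` by a rearrangement right of the cut and from `σ` by one left
    -- of it, so that both invariances of `f` apply.
    set υ : Fin N → Fin (n + 1) := fun x => if x.val < c then τ x else σ x with hυ
    have r1 : IsRearr c k υ τ := by
      refine ⟨fun x hx => ?_, ?_⟩
      · by_cases hxc : x.val < c
        · simp [hυ, hxc]
        · simp only [hυ, hxc, if_false]
          exact (h.1 x (by omega)).symm
      · rw [e2]
        funext i
        unfold valueCount
        congr 1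
        ext x
        simp only [mem_filter, mem_univ, true_and, and_congr_right_iff]
        intro hx
        simp [hυ, not_lt.2 hx.1]
    have r2 : IsRearr 0 c υ σ := by
      refine ⟨fun x hx => ?_, ?_⟩
      · simp only [hυ, show ¬ x.val < c by omega, if_false]
      · rw [← e1]
        funext i
        unfold valueCount
        congr 1
        ext x
        simp only [mem_filter, mem_univ, true_and, and_congr_right_iff]
        intro hx
        simp [hυ, hx.2]
    rw [← h2i.eq_of_isRearr r1, h1i.eq_of_isRearr r2]
  refine ⟨WithLp.toLp 2 fun σ => gauge lam θ σ * g (P σ), ?_, ?_⟩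
  · rw [mem_groundSpace_iff θ hlam hk]
    constructor
    · intro p q hp hq hqk σ
      have hr := isRearr_comp_swap (a := 0) (b := k) σ (p := p) (q := q) ⟨hp, by omega⟩
        ⟨by omega, hqk⟩
      have hPP : P (σ ∘ Equiv.swap p q) = P σ := by
        funext τ
        simp only [hP, eq_iff_iff, and_congr_right_iff]
        exact fun _ => ⟨fun h => h.trans hr, fun h => h.trans hr.symm⟩
      simp only [hPP]
      rw [mul_div_cancel_left₀ _ (hg _), mul_div_cancel_left₀ _ (hg _)]
    · intro p q hp hq hpq σ hσ hσ0
      simp only [g]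
      split_ifs with hex
      · obtain ⟨hs, hr⟩ := hex.choose_spec
        set τ := hex.choose
        have hcount : 1 < valueCount 0 k τ (σ p) := by
          rw [hr.2, valueCount, one_lt_card]
          exact ⟨p, by simp [hp.2], q, by simp [hq.2, hσ], hpq⟩
        rw [valueCount, one_lt_card] at hcount
        obtain ⟨p', hp', q', hq', hne⟩ := hcount
        simp only [mem_filter, mem_univ, true_and] at hp' hq'
        -- In a sorted configuration the two particles of the repeated species lie on the same side
        -- of the cut, where `w` is a ground state.
        have hz : w τ = 0 := by
          rcases lt_or_gt_of_ne (hlam1 _ hσ0) with hl | hl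
          · have key (x : Fin N) (hx : x.val < k) (hxp : τ x = σ p) : x.val < c := by
              by_contra hc
              have := (hs x).2 (by omega) hx
              rw [hxp] at this
              linarith
            exact h1z p' q' ⟨by omega, key p' hp'.1.2 hp'.2⟩ ⟨by omega, key q' hq'.1.2 hq'.2⟩
              hne τ (hp'.2.trans hq'.2.symm) (hp'.2 ▸ hσ0)
          · have key (x : Fin N) (hx : x.val < k) (hxp : τ x = σ p) : c ≤ x.val := by
              by_contra hc
              have := (hs x).1 (by omega)
              rw [hxp] at this
              linarith
            exact h2z p' q' ⟨key p' hp'.1.2 hp'.2, hp'.1.2⟩ ⟨key q' hq'.1.2 hq'.2, hq'.1.2⟩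
              hne τ (hp'.2.trans hq'.2.symm) (hp'.2 ▸ hσ0)
        simp [hf, hz]
      · simp
  · intro σ hσ
    have hex : ∃ τ, P σ τ := ⟨σ, hσ, IsRearr.refl _ _ _⟩
    obtain ⟨hs, hr⟩ := hex.choose_spec
    simp only [g, dif_pos hex, hfeq hσ hs hr]
    simp only [hf]
    rw [mul_div_cancel₀ _ (hg σ)]

end Extension

/-! ### Ground state projections of disjoint intervals. -/

section Projections

/-- A symmetric operator that preserves a subspace preserves its orthogonal complement as well. -/
lemma starProjection_map_of_isSymmetric {V : Type*} [NormedAddCommGroup V]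
    [InnerProductSpace ℂ V] {S : V →ₗ[ℂ] V} (hS : S.IsSymmetric) {K : Submodule ℂ V}
    [K.HasOrthogonalProjection] (hK : ∀ v ∈ K, S v ∈ K) (v : V) :
    K.starProjection (S v) = S (K.starProjection v) := by
  refine Submodule.eq_starProjection_of_mem_orthogonal
    (hK _ (Submodule.starProjection_apply_mem _ _)) ?_
  rw [← map_sub, Submodule.mem_orthogonal]
  intro u hu
  rw [← hS u]
  exact Submodule.sub_starProjection_mem_orthogonal v _ (hK u hu)

variable {lam : Fin (n + 1) → ℝ} (θ : Fin (n + 1) → Fin (n + 1) → ℝ) {N : ℕ}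

variable (lam N) in
/-- The orthogonal projection onto the ground space of the interval `[a, b)`. -/
noncomputable def groundProj (a b : ℕ) : Chain n N →L[ℂ] Chain n N :=
  (groundSpace lam θ N a b).starProjection

lemma groundProj_mem (a b : ℕ) (ψ : Chain n N) :
    groundProj lam θ N a b ψ ∈ groundSpace lam θ N a b :=
  Submodule.starProjection_apply_mem _ _

lemma groundProj_eq_self {a b : ℕ} {ψ : Chain n N} (h : ψ ∈ groundSpace lam θ N a b) :
    groundProj lam θ N a b ψ = ψ := Submodule.starProjection_eq_self_iff.2 h

lemma inner_groundProj (a b : ℕ) (ψ φ : Chain n N) :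
    inner ℂ (groundProj lam θ N a b ψ) φ = inner ℂ ψ (groundProj lam θ N a b φ) :=
  Submodule.inner_starProjection_left_eq_right _ _ _

lemma groundProj_mem_groundSpace (hlam : ∀ i, 0 < lam i) {a b a' b' : ℕ} (h : b ≤ a' ∨ b' ≤ a)
    {ψ : Chain n N} (hψ : ψ ∈ groundSpace lam θ N a' b') :
    groundProj lam θ N a b ψ ∈ groundSpace lam θ N a' b' := by
  intro x hx hxb
  have hcomm := starProjection_map_of_isSymmetric (bond_isSymmetric (N := N) θ hlam x)
    (K := groundSpace lam θ N a b) (by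
      intro v hv y hy hyb
      rcases h with h | h
      · rw [bond_comm θ hlam (by omega), hv y hy hyb, map_zero]
      · rw [← bond_comm θ hlam (by omega), hv y hy hyb, map_zero]) ψ
  rw [groundProj, ← hcomm, hψ x hx hxb, map_zero]

lemma groundProj_comm (hlam : ∀ i, 0 < lam i) {a b a' b' : ℕ} (h : b ≤ a') (ψ : Chain n N) :
    groundProj lam θ N a b (groundProj lam θ N a' b' ψ) =
      groundProj lam θ N a' b' (groundProj lam θ N a b ψ) :=
  starProjection_map_of_isSymmetric (S := (groundProj lam θ N a' b').toLinearMap)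
    (fun _ _ => inner_groundProj θ _ _ _ _) (K := groundSpace lam θ N a b)
    (fun _ hv => groundProj_mem_groundSpace θ hlam (Or.inr h) hv) ψ

end Projections

/-! ### Restriction of vectors to sets of configurations. -/

section Restrict

variable {N : ℕ}

open Classical in
/-- Restriction of a vector to the configurations that satisfy `P`. -/
noncomputable def restrictTo (P : (Fin N → Fin (n + 1)) → Prop) : Chain n N →ₗ[ℂ] Chain n N where
  toFun ψ := WithLp.toLp 2 fun σ => if P σ then ψ σ else 0
  map_add' ψ φ := by ext σ; simp only [PiLp.add_apply]; split_ifs <;> simp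
  map_smul' c ψ := by ext σ; simp

open Classical in
lemma restrictTo_apply (P : (Fin N → Fin (n + 1)) → Prop) (ψ : Chain n N)
    (σ : Fin N → Fin (n + 1)) : restrictTo P ψ σ = if P σ then ψ σ else 0 := rfl

lemma restrictTo_isSymmetric (P : (Fin N → Fin (n + 1)) → Prop) :
    (restrictTo (n := n) P).IsSymmetric := by
  intro ψ φ
  simp only [PiLp.inner_apply, restrictTo_apply]
  refine sum_congr rfl fun σ _ => ?_
  split_ifs <;> simp

lemma restrictTo_restrictTo (P : (Fin N → Fin (n + 1)) → Prop) (ψ : Chain n N) :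
    restrictTo P (restrictTo P ψ) = restrictTo P ψ := by
  ext σ
  simp only [restrictTo_apply]
  split_ifs <;> rfl

open Classical in
lemma norm_sq_restrictTo (P : (Fin N → Fin (n + 1)) → Prop) (ψ : Chain n N) :
    ‖restrictTo P ψ‖ ^ 2 = ∑ σ with P σ, ‖ψ σ‖ ^ 2 := by
  rw [EuclideanSpace.norm_sq_eq, sum_filter]
  refine sum_congr rfl fun σ _ => ?_
  rw [restrictTo_apply]
  split_ifs <;> simp

lemma norm_sq_restrictTo_mono {P Q : (Fin N → Fin (n + 1)) → Prop} (h : ∀ σ, P σ → Q σ)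
    (ψ : Chain n N) : ‖restrictTo P ψ‖ ^ 2 ≤ ‖restrictTo Q ψ‖ ^ 2 := by
  classical
  rw [norm_sq_restrictTo, norm_sq_restrictTo]
  refine sum_le_sum_of_subset_of_nonneg ?_ fun _ _ _ => by positivity
  intro σ hσ
  simp only [mem_filter, mem_univ, true_and] at hσ ⊢
  exact h σ hσ

lemma norm_restrictTo_le (P : (Fin N → Fin (n + 1)) → Prop) (ψ : Chain n N) :
    ‖restrictTo P ψ‖ ≤ ‖ψ‖ := by
  have h := norm_sq_restrictTo_mono (P := P) (Q := fun _ => True) (fun _ _ => trivial) ψ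
  have e : restrictTo (fun _ => True) ψ = ψ := by ext σ; simp [restrictTo_apply]
  rw [e] at h
  exact le_of_sq_le_sq h (norm_nonneg _)

lemma norm_sq_restrictTo_or_le (P Q : (Fin N → Fin (n + 1)) → Prop) (ψ : Chain n N) :
    ‖restrictTo (fun σ => P σ ∨ Q σ) ψ‖ ^ 2 ≤
      ‖restrictTo P ψ‖ ^ 2 + ‖restrictTo Q ψ‖ ^ 2 := by
  classical
  simp only [norm_sq_restrictTo]
  rw [sum_filter, sum_filter, sum_filter, ← sum_add_distrib]
  refine sum_le_sum fun σ _ => ?_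
  have := sq_nonneg ‖ψ σ‖
  by_cases h1 : P σ <;> by_cases h2 : Q σ <;> simp [h1, h2]

variable {lam : Fin (n + 1) → ℝ} (θ : Fin (n + 1) → Fin (n + 1) → ℝ)

lemma isSorted_comp_swap {c k : ℕ} {p q : Fin N} (hq : q.val = p.val + 1)
    (h : q.val < c ∨ (c ≤ p.val ∧ q.val < k)) (σ : Fin N → Fin (n + 1)) :
    IsSorted lam c k (σ ∘ Equiv.swap p q) ↔ IsSorted lam c k σ := by
  have key (τ : Fin N → Fin (n + 1)) (hτ : IsSorted lam c k τ) :
      IsSorted lam c k (τ ∘ Equiv.swap p q) := by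
    intro x
    rw [Function.comp_apply, Equiv.swap_apply_def]
    split_ifs with h1 h2
    · subst h1
      exact ⟨fun hx => (hτ q).1 (by omega), fun hx hx' => (hτ q).2 (by omega) (by omega)⟩
    · subst h2
      exact ⟨fun hx => (hτ p).1 (by omega), fun hx hx' => (hτ p).2 (by omega) (by omega)⟩
    · exact hτ x
  refine ⟨fun h' => ?_, key σ⟩
  have := key _ h'
  rwa [comp_swap_comp_swap] at this

/-- Bonds on one side of the cut exchange sites on that side only and so do not affect sortedness.
-/
lemma restrictTo_isSorted_mem (hlam : ∀ i, 0 < lam i) {a b c k : ℕ}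
    (h : b ≤ c ∨ (c ≤ a ∧ b ≤ k)) {ψ : Chain n N} (hψ : ψ ∈ groundSpace lam θ N a b) :
    restrictTo (IsSorted lam c k) ψ ∈ groundSpace lam θ N a b := by
  classical
  intro x hx hxb
  by_cases hxN : x + 1 < N
  swap
  · rw [bond_of_le θ hxN]; rfl
  obtain ⟨p, q, hp, hq, hpq⟩ := exists_sites hxN
  have h0 := hψ x hx hxb
  ext σ
  have h1 := congrArg (fun v : Chain n N => v σ) h0
  simp only [bond_apply_coeff θ hlam hxN hp hq, PiLp.zero_apply, restrictTo_apply,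
    isSorted_comp_swap (lam := lam) (c := c) (k := k) (p := p) (q := q) (by omega)
      (by omega) σ] at h1 ⊢
  split_ifs
  · exact h1
  · simp

end Restrict

/-! ### Near-orthogonality of new excitations and block ground states. -/

section Overlap

variable {lam : Fin (n + 1) → ℝ} (θ : Fin (n + 1) → Fin (n + 1) → ℝ) {N : ℕ}

lemma restrictTo_add_restrictTo_not (P : (Fin N → Fin (n + 1)) → Prop) (ψ : Chain n N) :
    restrictTo P ψ + restrictTo (fun σ => ¬ P σ) ψ = ψ := by
  classical
  ext σ
  simp only [PiLp.add_apply, restrictTo_apply]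
  by_cases h : P σ <;> simp [h]

lemma misplacedBound_nonneg {q : ℝ} (hq0 : 0 < q) (hq1 : q < 1) (m : ℕ) :
    0 ≤ misplacedBound n q m := by
  have : 0 < 1 - q := by linarith
  unfold misplacedBound
  positivity

/-- A sorted ground state on both sides of a cut is almost a ground state. -/
lemma exists_near_groundSpace (hlam : ∀ i, 0 < lam i) (hlam0 : lam 0 = 1) {q : ℝ}
    (hq0 : 0 < q) (hq1 : q < 1) (hsp : ∀ i, i ≠ 0 → lam i ≤ q ∨ 1 ≤ q * lam i)
    (hlam1 : ∀ i, i ≠ 0 → lam i ≠ 1) {c k m : ℕ} (hk : k ≤ N) (hc : n + m ≤ c)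
    (hck : c + n + m ≤ k) (hD : misplacedBound n q m ≤ 1 / 4) {w : Chain n N}
    (h1 : w ∈ groundSpace lam θ N 0 c) (h2 : w ∈ groundSpace lam θ N c k)
    (hw : restrictTo (IsSorted lam c k) w = w) :
    ∃ v ∈ groundSpace lam θ N 0 k, ‖w - v‖ ≤ 2 * √(misplacedBound n q m) * ‖w‖ := by
  set D := misplacedBound n q m with hDdef
  have hD0 : 0 ≤ D := misplacedBound_nonneg hq0 hq1 m
  obtain ⟨v, hv, hvw⟩ := exists_extension θ hlam hlam1 (by omega) hk h1 h2
  refine ⟨v, hv, ?_⟩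
  have e1 : restrictTo (IsSorted lam c k) v = w := by
    rw [← hw]
    ext σ
    simp only [restrictTo_apply]
    split_ifs with hσ
    · exact hvw σ hσ
    · rfl
  have e2 : restrictTo (fun σ => ¬ IsSorted lam c k σ) v = v - w := by
    rw [eq_sub_iff_add_eq', ← e1]; exact restrictTo_add_restrictTo_not _ _
  have b1 : ‖v - w‖ ^ 2 ≤ 2 * D * ‖v‖ ^ 2 := by
    rw [← e2]
    calc _ ≤ ‖restrictTo (fun σ => HasRightMover lam c σ ∨ HasLeftMover lam c k σ) v‖ ^ 2 :=
          norm_sq_restrictTo_mono (fun σ hσ => by rw [isSorted_iff] at hσ; tauto) v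
      _ ≤ _ := norm_sq_restrictTo_or_le _ _ v
      _ ≤ D * ‖v‖ ^ 2 + D * ‖v‖ ^ 2 := by
          rw [norm_sq_restrictTo, norm_sq_restrictTo]
          exact add_le_add
            (sum_norm_sq_hasRightMover_le θ hlam hlam0 hq0 hq1 hsp hk hck hv)
            (sum_norm_sq_hasLeftMover_le θ hlam hlam0 hq0 hq1 hsp hk (by omega) hv)
      _ = _ := by ring
  have b2 : ‖v‖ ^ 2 = ‖w‖ ^ 2 + ‖v - w‖ ^ 2 := by
    have h0 : inner ℂ w (v - w) = 0 := by
      rw [← e2, ← e1, restrictTo_isSymmetric]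
      have : restrictTo (IsSorted lam c k) (restrictTo (fun σ => ¬ IsSorted lam c k σ) v) = 0 := by
        ext σ
        simp only [restrictTo_apply, PiLp.zero_apply]
        by_cases h : IsSorted lam c k σ <;> simp [h]
      rw [this, inner_zero_right]
    have := norm_add_sq_eq_norm_sq_add_norm_sq_of_inner_eq_zero w (v - w) h0
    rw [add_sub_cancel] at this
    rw [sq, sq, sq, this]
  have b3 : ‖w - v‖ ^ 2 ≤ (2 * √D * ‖w‖) ^ 2 := by
    rw [norm_sub_rev, mul_pow, mul_pow, Real.sq_sqrt hD0]
    -- Since `D ≤ 1 / 4`, the unsorted part `v - w` carries at most half of the squared norm of `v`.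
    have : ‖v‖ ^ 2 ≤ 2 * ‖w‖ ^ 2 := by nlinarith [sq_nonneg ‖v‖]
    nlinarith
  exact le_of_sq_le_sq b3 (by positivity)

/-- The overlap between excitations of `[0, k + 1)` that are ground states of `[0, k)` and the
ground states of a block at the end of the interval. -/
lemma norm_inner_groundSpace_le (hlam : ∀ i, 0 < lam i) (hlam0 : lam 0 = 1) {q : ℝ}
    (hq0 : 0 < q) (hq1 : q < 1) (hsp : ∀ i, i ≠ 0 → lam i ≤ q ∨ 1 ≤ q * lam i)
    (hlam1 : ∀ i, i ≠ 0 → lam i ≠ 1) {k m : ℕ} (hk : k + 1 ≤ N) (hkm : 2 * (n + m) ≤ k)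
    (hD : misplacedBound n q m ≤ 1 / 4) {u v : Chain n N}
    (hu : u ∈ groundSpace lam θ N (k - 2 * (n + m)) (k + 1))
    (hv : v ∈ groundSpace lam θ N 0 k) (hv' : v ∈ (groundSpace lam θ N 0 (k + 1))ᗮ) :
    ‖inner ℂ u v‖ ≤ 4 * √(misplacedBound n q m) * ‖u‖ * ‖v‖ := by
  set D := misplacedBound n q m with hDdef
  have hD0 : 0 ≤ D := misplacedBound_nonneg hq0 hq1 m
  -- The cut is `n + m` sites before `k` and `n + m` sites after the start of the block: just enough
  -- room to control right movers through `v` and left movers through `u`.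
  obtain ⟨c, hc⟩ : ∃ c, k = c + (n + m) := ⟨k - (n + m), by omega⟩
  set R : (Fin N → Fin (n + 1)) → Prop := HasRightMover lam c with hR
  set L : (Fin N → Fin (n + 1)) → Prop := fun σ => ¬ R σ ∧ HasLeftMover lam c (k + 1) σ with hL
  set S : (Fin N → Fin (n + 1)) → Prop := IsSorted lam c (k + 1) with hS
  have hsplit : u = restrictTo S u + restrictTo R u + restrictTo L u := by
    ext σ
    have h := isSorted_iff (lam := lam) (c := c) (k := k + 1) σ
    simp only [PiLp.add_apply, restrictTo_apply, hS, hL, hR]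
    by_cases h1 : HasRightMover lam c σ <;> by_cases h2 : HasLeftMover lam c (k + 1) σ <;>
      simp [h, h1, h2]
  have bR : ‖inner ℂ (restrictTo R u) v‖ ≤ √D * ‖u‖ * ‖v‖ := by
    rw [restrictTo_isSymmetric]
    refine (norm_inner_le_norm _ _).trans ?_
    have : ‖restrictTo R v‖ ≤ √D * ‖v‖ := by
      refine le_of_sq_le_sq ?_ (by positivity)
      rw [mul_pow, Real.sq_sqrt hD0, norm_sq_restrictTo]
      exact sum_norm_sq_hasRightMover_le θ hlam hlam0 hq0 hq1 hsp (by omega) (by omega) hv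
    calc _ ≤ ‖u‖ * (√D * ‖v‖) := by gcongr
      _ = _ := by ring
  have bL : ‖inner ℂ (restrictTo L u) v‖ ≤ √D * ‖u‖ * ‖v‖ := by
    refine (norm_inner_le_norm _ _).trans ?_
    have : ‖restrictTo L u‖ ≤ √D * ‖u‖ := by
      refine le_of_sq_le_sq ?_ (by positivity)
      rw [mul_pow, Real.sq_sqrt hD0]
      refine (norm_sq_restrictTo_mono (Q := HasLeftMover lam c (k + 1))
        (fun σ hσ => hσ.2) u).trans ?_
      rw [norm_sq_restrictTo]
      exact sum_norm_sq_hasLeftMover_le θ hlam hlam0 hq0 hq1 hsp hk (by omega) hu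
    gcongr
  have bS : ‖inner ℂ (restrictTo S u) v‖ ≤ 2 * √D * ‖u‖ * ‖v‖ := by
    -- Projecting onto ground states of `[0, c)` does not change the inner product with `v`. The
    -- result is a sorted ground state of both sides, hence close to a ground state of `[0, k + 1)`,
    -- to which `v` is orthogonal.
    set w := groundProj lam θ N 0 c (restrictTo S u) with hw
    have hvc : v ∈ groundSpace lam θ N 0 c := groundSpace_mono θ le_rfl (by omega) hv
    have hSu : restrictTo S u ∈ groundSpace lam θ N c (k + 1) :=
      restrictTo_isSorted_mem θ hlam (Or.inr ⟨le_rfl, le_rfl⟩)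
        (groundSpace_mono θ (by omega) le_rfl hu)
    have hw1 : w ∈ groundSpace lam θ N 0 c := groundProj_mem θ _ _ _
    have hw2 : w ∈ groundSpace lam θ N c (k + 1) :=
      groundProj_mem_groundSpace θ hlam (Or.inl le_rfl) hSu
    have hw3 : restrictTo S w = w := by
      have := starProjection_map_of_isSymmetric (restrictTo_isSymmetric (n := n) S)
        (K := groundSpace lam θ N 0 c)
        (fun v hv => restrictTo_isSorted_mem θ hlam (Or.inl le_rfl) hv) (restrictTo S u)
      rw [restrictTo_restrictTo] at this
      exact this.symm
    obtain ⟨w', hw', hww'⟩ := exists_near_groundSpace θ hlam hlam0 hq0 hq1 hsp hlam1 hk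
      (by omega) (by omega) hD hw1 hw2 hw3
    have hwn : ‖w‖ ≤ ‖u‖ :=
      (Submodule.norm_starProjection_apply_le _ _).trans (norm_restrictTo_le _ _)
    have e : inner ℂ (restrictTo S u) v = inner ℂ (w - w') v := by
      rw [inner_sub_left, (Submodule.mem_orthogonal _ _).1 hv' w' hw', sub_zero, hw,
        inner_groundProj, groundProj_eq_self θ hvc]
    rw [e]
    refine (norm_inner_le_norm _ _).trans ?_
    gcongr
    exact hww'.trans (by gcongr)
  rw [hsplit, inner_add_left, inner_add_left]
  refine (norm_add₃_le).trans ?_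
  rw [← hsplit]
  linarith

end Overlap

/-! ### Gap of blocks of bounded length, uniform in their position. -/

section LocalGap

variable {lam : Fin (n + 1) → ℝ} (θ : Fin (n + 1) → Fin (n + 1) → ℝ) {N : ℕ}

/-- On the orthogonal complement of the ground space the bonds are jointly injective, and an
injective linear map on a finite-dimensional space is bounded below. -/
lemma exists_gap_single (L : ℕ) : ∃ C : ℝ, 0 ≤ C ∧ ∀ v : Chain n L,
    ‖v - groundProj lam θ L 0 L v‖ ^ 2 ≤ C * ∑ x ∈ range (L - 1), ‖bond lam θ L x v‖ ^ 2 := by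
  set K := groundSpace lam θ L 0 L with hK
  let A : Kᗮ →ₗ[ℂ] (Fin (L - 1) → Chain n L) :=
    LinearMap.pi fun x => bond lam θ L x.val ∘ₗ Kᗮ.subtype
  have hA : LinearMap.ker A = ⊥ := by
    rw [LinearMap.ker_eq_bot']
    intro v hv
    have hvK : (v : Chain n L) ∈ K := by
      intro x _ hx
      exact congrFun hv ⟨x, by omega⟩
    have := Submodule.inner_right_of_mem_orthogonal hvK v.2
    exact Subtype.ext (inner_self_eq_zero.1 this)
  obtain ⟨c, -, hc⟩ := A.exists_antilipschitzWith hA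
  refine ⟨c ^ 2, by positivity, fun v => ?_⟩
  have hmem : v - groundProj lam θ L 0 L v ∈ Kᗮ := Submodule.sub_starProjection_mem_orthogonal v
  have h1 := ZeroHomClass.bound_of_antilipschitz A hc ⟨_, hmem⟩
  have hbond (x : ℕ) (hx : x + 1 < L) :
      bond lam θ L x (v - groundProj lam θ L 0 L v) = bond lam θ L x v := by
    rw [map_sub, groundProj_mem θ 0 L v x (Nat.zero_le _) hx, sub_zero]
  have h2 : ‖A ⟨_, hmem⟩‖ ≤ √(∑ x ∈ range (L - 1), ‖bond lam θ L x v‖ ^ 2) := by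
    rw [pi_norm_le_iff_of_nonneg (Real.sqrt_nonneg _)]
    intro x
    have hx := x.isLt
    change ‖bond lam θ L x.val (v - groundProj lam θ L 0 L v)‖ ≤ _
    rw [hbond _ (by omega)]
    apply Real.le_sqrt_of_sq_le
    exact single_le_sum (f := fun x => ‖bond lam θ L x v‖ ^ 2) (fun _ _ => by positivity)
      (mem_range.2 hx)
  have h3 : ‖v - groundProj lam θ L 0 L v‖ ≤
      c * √(∑ x ∈ range (L - 1), ‖bond lam θ L x v‖ ^ 2) :=
    h1.trans (mul_le_mul_of_nonneg_left h2 c.2)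
  calc _ ≤ (c * √(∑ x ∈ range (L - 1), ‖bond lam θ L x v‖ ^ 2)) ^ 2 := by gcongr
    _ = _ := by rw [mul_pow, Real.sq_sqrt (sum_nonneg fun _ _ => by positivity)]

/-- The configuration `σ` with the block of `L` sites that starts at `a` overwritten by `τ`. -/
def overwrite (a : ℕ) {L : ℕ} (σ : Fin N → Fin (n + 1)) (τ : Fin L → Fin (n + 1)) :
    Fin N → Fin (n + 1) :=
  fun y => if h : a ≤ y.val ∧ y.val < a + L then τ ⟨y.val - a, by omega⟩ else σ y

/-- The restriction of a configuration to the block of `L` sites that starts at `a`. -/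
def blockOf (a : ℕ) {L : ℕ} (h : a + L ≤ N) (σ : Fin N → Fin (n + 1)) : Fin L → Fin (n + 1) :=
  fun j => σ ⟨a + j.val, by omega⟩

variable {a L : ℕ}

lemma overwrite_blockOf (h : a + L ≤ N) (σ : Fin N → Fin (n + 1)) : overwrite a σ (blockOf a h σ) = σ := by
  funext y
  simp only [overwrite, blockOf]
  split_ifs with hy
  · congr 1
    exact Fin.ext (by simp; omega)
  · rfl

lemma overwrite_overwrite (σ : Fin N → Fin (n + 1)) (τ τ' : Fin L → Fin (n + 1)) :
    overwrite a (overwrite a σ τ) τ' = overwrite a σ τ' := by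
  funext y
  simp only [overwrite]
  split_ifs <;> rfl

lemma blockOf_overwrite (h : a + L ≤ N) (σ : Fin N → Fin (n + 1)) (τ : Fin L → Fin (n + 1)) :
    blockOf a h (overwrite a σ τ) = τ := by
  funext j
  have := j.isLt
  simp [blockOf, overwrite]

lemma overwrite_comp_swap (σ : Fin N → Fin (n + 1)) (τ : Fin L → Fin (n + 1)) {p q : Fin L}
    {p' q' : Fin N} (hp : p'.val = a + p.val) (hq : q'.val = a + q.val) :
    overwrite a σ (τ ∘ Equiv.swap p q) = overwrite a σ τ ∘ Equiv.swap p' q' := by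
  have hpL := p.isLt
  have hqL := q.isLt
  funext y
  simp only [overwrite, Function.comp_apply]
  by_cases hy : a ≤ y.val ∧ y.val < a + L
  · rw [dif_pos hy]
    by_cases h1 : y = p'
    · have e : (⟨y.val - a, by omega⟩ : Fin L) = p := Fin.ext (by simp; omega)
      have e' : (⟨q'.val - a, by omega⟩ : Fin L) = q := Fin.ext (by simp; omega)
      have : a ≤ q'.val ∧ q'.val < a + L := by omega
      rw [e, Equiv.swap_apply_left, h1, Equiv.swap_apply_left, dif_pos this, e']
    by_cases h2 : y = q'
    · have e : (⟨y.val - a, by omega⟩ : Fin L) = q := Fin.ext (by simp; omega)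
      have e' : (⟨p'.val - a, by omega⟩ : Fin L) = p := Fin.ext (by simp; omega)
      have : a ≤ p'.val ∧ p'.val < a + L := by omega
      rw [e, Equiv.swap_apply_right, h2, Equiv.swap_apply_right, dif_pos this, e']
    · have n1 : (⟨y.val - a, by omega⟩ : Fin L) ≠ p := by
        intro hh; apply h1; have := congrArg Fin.val hh; exact Fin.ext (by simp at this; omega)
      have n2 : (⟨y.val - a, by omega⟩ : Fin L) ≠ q := by
        intro hh; apply h2; have := congrArg Fin.val hh; exact Fin.ext (by simp at this; omega)
      rw [Equiv.swap_apply_of_ne_of_ne n1 n2, Equiv.swap_apply_of_ne_of_ne h1 h2, dif_pos hy]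
  · have n1 : y ≠ p' := by rintro rfl; omega
    have n2 : y ≠ q' := by rintro rfl; omega
    rw [dif_neg hy, Equiv.swap_apply_of_ne_of_ne n1 n2, dif_neg hy]

/-- The vector on the block that one obtains by freezing the configuration outside the block. -/
noncomputable def blockSlice (a L : ℕ) (σ : Fin N → Fin (n + 1)) (ψ : Chain n N) : Chain n L :=
  WithLp.toLp 2 fun τ => ψ (overwrite a σ τ)

lemma blockSlice_apply (σ : Fin N → Fin (n + 1)) (ψ : Chain n N) (τ : Fin L → Fin (n + 1)) :
    blockSlice a L σ ψ τ = ψ (overwrite a σ τ) := rfl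

lemma apply_eq_blockSlice (h : a + L ≤ N) (σ : Fin N → Fin (n + 1)) (ψ : Chain n N) :
    ψ σ = blockSlice a L σ ψ (blockOf a h σ) := by
  rw [blockSlice_apply, overwrite_blockOf]

/-- Exchanging the content of the block with `τ` is an involution of the pairs `(σ, τ)`. -/
lemma sum_norm_sq_blockSlice (h : a + L ≤ N) (ψ : Chain n N) :
    ∑ σ, ‖blockSlice a L σ ψ‖ ^ 2 = Fintype.card (Fin L → Fin (n + 1)) * ‖ψ‖ ^ 2 := by
  have hinv : Function.Involutive
      (fun r : (Fin N → Fin (n + 1)) × (Fin L → Fin (n + 1)) =>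
        (overwrite a r.1 r.2, blockOf a h r.1)) := by
    rintro ⟨σ, τ⟩
    simp only [overwrite_overwrite, overwrite_blockOf, blockOf_overwrite]
  have e := Equiv.sum_comp hinv.toPerm (fun r => ‖ψ r.1‖ ^ 2)
  simp only [Function.Involutive.coe_toPerm] at e
  rw [Fintype.sum_prod_type, Fintype.sum_prod_type] at e
  simp only [EuclideanSpace.norm_sq_eq, blockSlice_apply]
  rw [e, mul_sum]
  simp only [sum_const, nsmul_eq_mul, card_univ]

lemma blockSlice_bond (h : a + L ≤ N) (hlam : ∀ i, 0 < lam i) {x : ℕ} (hx : x + 1 < L)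
    (σ : Fin N → Fin (n + 1)) (ψ : Chain n N) :
    blockSlice a L σ (bond lam θ N (a + x) ψ) = bond lam θ L x (blockSlice a L σ ψ) := by
  obtain ⟨p, q, hp, hq, hpq⟩ := exists_sites (N := L) hx
  obtain ⟨p', q', hp', hq', hpq'⟩ := exists_sites (N := N) (x := a + x) (by omega)
  ext τ
  have v1 : overwrite a σ τ p' = τ p := by
    have : a ≤ p'.val ∧ p'.val < a + L := by omega
    rw [overwrite, dif_pos this]
    congr 1
    exact Fin.ext (by simp; omega)
  have v2 : overwrite a σ τ q' = τ q := by
    have : a ≤ q'.val ∧ q'.val < a + L := by omega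
    rw [overwrite, dif_pos this]
    congr 1
    exact Fin.ext (by simp; omega)
  rw [blockSlice_apply, bond_apply_coeff θ hlam (by omega) hp' hq',
    bond_apply_coeff θ hlam hx hp hq, v1, v2, blockSlice_apply, blockSlice_apply,
    overwrite_comp_swap σ τ (p' := p') (q' := q') (by omega) (by omega)]

/-- Projecting every slice of `ψ` gives a block ground state, whose distance to `ψ` is at least that
of the orthogonal projection; the estimate on `L` sites is then summed over the slices. -/
lemma exists_gap_block (hlam : ∀ i, 0 < lam i) (L : ℕ) : ∃ C : ℝ, 0 ≤ C ∧
    ∀ (N a : ℕ), a + L ≤ N → ∀ ψ : Chain n N,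
      ‖ψ - groundProj lam θ N a (a + L) ψ‖ ^ 2 ≤
        C * ∑ x ∈ range (L - 1), ‖bond lam θ N (a + x) ψ‖ ^ 2 := by
  obtain ⟨C, hC, hgap⟩ := exists_gap_single (lam := lam) θ L
  refine ⟨C, hC, fun N a h ψ => ?_⟩
  set φ : Chain n N := WithLp.toLp 2 fun σ =>
    groundProj lam θ L 0 L (blockSlice a L σ ψ) (blockOf a h σ) with hφ
  have hslice (σ) : blockSlice a L σ φ = groundProj lam θ L 0 L (blockSlice a L σ ψ) := by
    ext τ
    rw [blockSlice_apply]
    change groundProj lam θ L 0 L (blockSlice a L (overwrite a σ τ) ψ)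
      (blockOf a h (overwrite a σ τ)) = _
    rw [blockOf_overwrite]
    have : blockSlice a L (overwrite a σ τ) ψ = blockSlice a L σ ψ := by
      ext τ'
      rw [blockSlice_apply, blockSlice_apply, overwrite_overwrite]
    rw [this]
  have hφmem : φ ∈ groundSpace lam θ N a (a + L) := by
    intro x hx hxL
    obtain ⟨y, rfl⟩ := Nat.exists_eq_add_of_le hx
    ext σ
    rw [apply_eq_blockSlice h, blockSlice_bond θ h hlam (by omega), hslice,
      groundProj_mem θ 0 L _ y (Nat.zero_le _) (by omega)]
    rfl
  have hmin : ‖ψ - groundProj lam θ N a (a + L) ψ‖ ≤ ‖ψ - φ‖ := by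
    have h0 := norm_add_sq_eq_norm_sq_add_norm_sq_of_inner_eq_zero
      (ψ - groundProj lam θ N a (a + L) ψ) (groundProj lam θ N a (a + L) ψ - φ)
      (Submodule.inner_left_of_mem_orthogonal
        (sub_mem (groundProj_mem θ _ _ _) hφmem)
        (Submodule.sub_starProjection_mem_orthogonal ψ))
    rw [sub_add_sub_cancel] at h0
    nlinarith [norm_nonneg (ψ - φ), norm_nonneg (ψ - groundProj lam θ N a (a + L) ψ),
      norm_nonneg (groundProj lam θ N a (a + L) ψ - φ)]
  have hcard : (0 : ℝ) < Fintype.card (Fin L → Fin (n + 1)) := by exact_mod_cast Fintype.card_pos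
  refine le_of_mul_le_mul_left ?_ hcard
  calc (Fintype.card (Fin L → Fin (n + 1)) : ℝ) * ‖ψ - groundProj lam θ N a (a + L) ψ‖ ^ 2
      ≤ Fintype.card (Fin L → Fin (n + 1)) * ‖ψ - φ‖ ^ 2 := by gcongr
    _ = ∑ σ, ‖blockSlice a L σ ψ - groundProj lam θ L 0 L (blockSlice a L σ ψ)‖ ^ 2 := by
        rw [← sum_norm_sq_blockSlice h]
        refine sum_congr rfl fun σ _ => ?_
        rw [← hslice]
        rfl
    _ ≤ ∑ σ, C * ∑ x ∈ range (L - 1), ‖blockSlice a L σ (bond lam θ N (a + x) ψ)‖ ^ 2 := by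
        refine sum_le_sum fun σ _ => (hgap _).trans (le_of_eq ?_)
        congr 1
        refine sum_congr rfl fun x hx => ?_
        rw [blockSlice_bond θ h hlam (by simp at hx; omega)]
    _ = C * ∑ x ∈ range (L - 1), ∑ σ, ‖blockSlice a L σ (bond lam θ N (a + x) ψ)‖ ^ 2 := by
        rw [← mul_sum, sum_comm]
    _ = _ := by
        simp only [sum_norm_sq_blockSlice h]
        rw [← mul_sum]
        ring

lemma exists_gap_blocks (hlam : ∀ i, 0 < lam i) (M : ℕ) : ∃ C : ℝ, 0 ≤ C ∧
    ∀ (N a b : ℕ), a ≤ b → b ≤ a + M → b + 1 ≤ N → ∀ ψ : Chain n N,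
      ‖ψ - groundProj lam θ N a (b + 1) ψ‖ ^ 2 ≤
        C * ∑ x ∈ Ico a b, ‖bond lam θ N x ψ‖ ^ 2 := by
  choose C hC hgap using exists_gap_block (lam := lam) θ hlam
  refine ⟨∑ L ∈ range (M + 2), C L, sum_nonneg fun L _ => hC L, fun N a b hab hb hN ψ => ?_⟩
  have h1 := hgap (b + 1 - a) N a (by omega) ψ
  rw [show a + (b + 1 - a) = b + 1 by omega, show b + 1 - a - 1 = b - a by omega] at h1
  rw [sum_Ico_eq_sum_range]
  refine h1.trans (mul_le_mul_of_nonneg_right ?_ (sum_nonneg fun _ _ => by positivity))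
  exact single_le_sum (f := C) (fun L _ => hC L) (by simp; omega)

end LocalGap

/-! ### The martingale argument for a uniform gap. -/

section Martingale

variable {lam : Fin (n + 1) → ℝ} (θ : Fin (n + 1) → Fin (n + 1) → ℝ) {N : ℕ}

/-- Each unit increase of the shift adds a telescoping sum worth at most `p 0`; truncated
subtraction supplies the boundary terms. -/
lemma sum_range_sub_shift_le {p : ℕ → ℝ} (hp : ∀ m, 0 ≤ p m) (N l : ℕ) :
    ∑ m ∈ range N, (p (m - l) - p (m + 1)) ≤ (l + 1) * p 0 := by
  induction l with
  | zero =>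
    simp only [Nat.sub_zero, sum_range_sub', Nat.cast_zero, zero_add, one_mul]
    linarith [hp N]
  | succ l ih =>
    have e (N : ℕ) : ∑ m ∈ range N, (p (m - (l + 1)) - p (m - l)) = p 0 - p (N - (l + 1)) := by
      induction N with
      | zero => simp
      | succ N ihN => rw [sum_range_succ, ihN, Nat.add_sub_add_right]; ring
    have e2 : ∑ m ∈ range N, (p (m - (l + 1)) - p (m + 1)) =
        ∑ m ∈ range N, (p (m - (l + 1)) - p (m - l)) + ∑ m ∈ range N, (p (m - l) - p (m + 1)) := by
      rw [← sum_add_distrib]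
      exact sum_congr rfl fun _ _ => by ring
    rw [e2, e]
    push_cast
    linarith [hp (N - (l + 1))]

lemma groundProj_sub_mem_orthogonal {j k : ℕ} (hjk : j ≤ k) (ψ : Chain n N) :
    groundProj lam θ N 0 j ψ - groundProj lam θ N 0 k ψ ∈ (groundSpace lam θ N 0 k)ᗮ := by
  rw [Submodule.mem_orthogonal]
  intro u hu
  rw [inner_sub_right, ← inner_groundProj, ← inner_groundProj, groundProj_eq_self θ hu,
    groundProj_eq_self θ (groundSpace_mono θ le_rfl hjk hu), sub_self]

lemma norm_sq_groundProj_sub {j k : ℕ} (hjk : j ≤ k) (ψ : Chain n N) :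
    ‖groundProj lam θ N 0 j ψ - groundProj lam θ N 0 k ψ‖ ^ 2 =
      ‖groundProj lam θ N 0 j ψ‖ ^ 2 - ‖groundProj lam θ N 0 k ψ‖ ^ 2 := by
  have h := norm_add_sq_eq_norm_sq_add_norm_sq_of_inner_eq_zero
    (groundProj lam θ N 0 k ψ) (groundProj lam θ N 0 j ψ - groundProj lam θ N 0 k ψ)
    (Submodule.inner_right_of_mem_orthogonal (groundProj_mem θ 0 k ψ)
      (groundProj_sub_mem_orthogonal θ hjk ψ))
  rw [add_sub_cancel] at h
  rw [sq, sq, sq, h]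
  ring

/-- With `E` the increment, `‖E‖² = ⟨E, ψ - gψ⟩ + ⟨gE, ψ⟩`. The block projection `g` commutes with
that of `[0, m - l)` and `gE` is orthogonal to `Y`, so `ψ` may be replaced by `X - Y` in the last
term, while the overlap bound gives `‖gE‖ ≤ ε‖E‖`. -/
lemma norm_sq_step_le (hlam : ∀ i, 0 < lam i) {ε : ℝ} (hε : 0 ≤ ε) {l m : ℕ}
    (hov : l ≤ m → ∀ u v : Chain n N, u ∈ groundSpace lam θ N (m - l) (m + 1) →
      v ∈ groundSpace lam θ N 0 m → v ∈ (groundSpace lam θ N 0 (m + 1))ᗮ →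
      ‖inner ℂ u v‖ ≤ ε * ‖u‖ * ‖v‖) (ψ : Chain n N) :
    ‖groundProj lam θ N 0 m ψ‖ ^ 2 - ‖groundProj lam θ N 0 (m + 1) ψ‖ ^ 2 ≤
      2 * ‖ψ - groundProj lam θ N (m - l) (m + 1) ψ‖ ^ 2 +
      2 * ε ^ 2 * (‖groundProj lam θ N 0 (m - l) ψ‖ ^ 2 -
        ‖groundProj lam θ N 0 (m + 1) ψ‖ ^ 2) := by
  rw [← norm_sq_groundProj_sub θ (Nat.le_succ m),
    ← norm_sq_groundProj_sub θ (show m - l ≤ m + 1 by omega)]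
  set E := groundProj lam θ N 0 m ψ - groundProj lam θ N 0 (m + 1) ψ with hE
  set g := groundProj lam θ N (m - l) (m + 1) with hg
  set X := groundProj lam θ N 0 (m - l) ψ
  set Y := groundProj lam θ N 0 (m + 1) ψ with hY
  have hE1 : E ∈ (groundSpace lam θ N 0 (m + 1))ᗮ :=
    groundProj_sub_mem_orthogonal θ (Nat.le_succ m) ψ
  have hYmem : Y ∈ groundSpace lam θ N 0 (m + 1) := groundProj_mem θ _ _ _
  have hE2 : E ∈ groundSpace lam θ N 0 m :=
    sub_mem (groundProj_mem θ _ _ _) (groundSpace_mono θ le_rfl (Nat.le_succ m) hYmem)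
  have hEY : inner ℂ E Y = 0 := Submodule.inner_left_of_mem_orthogonal hYmem hE1
  have hEE : inner ℂ E E = inner ℂ E ψ := by
    conv_lhs => rw [hE, inner_sub_right, hEY, sub_zero, ← inner_groundProj,
      groundProj_eq_self θ hE2]
  have hgE : ‖inner ℂ E (g ψ)‖ ≤ ‖E‖ * (ε * ‖X - Y‖) := by
    rw [hg, ← inner_groundProj, ← hg]
    -- For `m < l` the truncated difference is 0, the block is all of `[0, m + 1)`, and `g` kills
    -- `E`.
    rcases Nat.lt_or_ge m l with hml | hml
    · have h0 : g E = 0 := by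
        have hgg : g = groundProj lam θ N 0 (m + 1) := by
          rw [hg, Nat.sub_eq_zero_of_le hml.le]
        rw [hgg]
        exact (Submodule.starProjection_apply_eq_zero_iff _).2 hE1
      rw [h0, inner_zero_left, norm_zero]
      positivity
    · have e1 : inner ℂ (g E) ψ = inner ℂ (g E) (X - Y) := by
        have a1 : inner ℂ (g E) Y = 0 := by
          rw [hg, inner_groundProj, groundProj_eq_self θ
            (groundSpace_mono θ (Nat.zero_le _) le_rfl hYmem), hEY]
        have a2 : groundProj lam θ N 0 (m - l) (g E) = g E := by
          rw [hg, groundProj_comm θ hlam le_rfl,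
            groundProj_eq_self θ (groundSpace_mono θ le_rfl (Nat.sub_le _ _) hE2)]
        rw [inner_sub_right, a1, sub_zero, ← inner_groundProj, a2]
      have e2 : ‖g E‖ ≤ ε * ‖E‖ := by
        have h1 := hov hml (g E) E (groundProj_mem θ _ _ _) hE2 hE1
        have h2 : inner ℂ (g E) E = (‖g E‖ : ℂ) ^ 2 := by
          refine Eq.trans ?_ (inner_self_eq_norm_sq_to_K (𝕜 := ℂ) (g E))
          conv_rhs => rw [hg, inner_groundProj, groundProj_eq_self θ (groundProj_mem θ _ _ _)]
          rw [hg, inner_groundProj]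
        rw [h2, norm_pow, Complex.norm_real, norm_norm] at h1
        rcases (norm_nonneg (g E)).eq_or_lt with h0 | h0
        · rw [← h0]; positivity
        · nlinarith
      rw [e1]
      calc _ ≤ ‖g E‖ * ‖X - Y‖ := norm_inner_le_norm _ _
        _ ≤ (ε * ‖E‖) * ‖X - Y‖ := by gcongr
        _ = _ := by ring
  have hmain : ‖E‖ ^ 2 ≤ ‖E‖ * (‖ψ - g ψ‖ + ε * ‖X - Y‖) := by
    have h1 : (‖E‖ : ℂ) ^ 2 = inner ℂ E (ψ - g ψ) + inner ℂ E (g ψ) := by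
      rw [← inner_add_right, sub_add_cancel, ← hEE]
      exact (inner_self_eq_norm_sq_to_K (𝕜 := ℂ) E).symm
    have h2 := congrArg norm h1
    rw [norm_pow, Complex.norm_real, norm_norm] at h2
    rw [h2]
    refine (norm_add_le _ _).trans ?_
    have := norm_inner_le_norm (𝕜 := ℂ) E (ψ - g ψ)
    linarith
  have hle : ‖E‖ ≤ ‖ψ - g ψ‖ + ε * ‖X - Y‖ := by
    rcases (norm_nonneg E).eq_or_lt with h0 | h0
    · rw [← h0]; positivity
    · nlinarith
  calc ‖E‖ ^ 2 ≤ (‖ψ - g ψ‖ + ε * ‖X - Y‖) ^ 2 := by gcongr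
    _ ≤ _ := by nlinarith [sq_nonneg (‖ψ - g ψ‖ - ε * ‖X - Y‖)]

/-- Exponential decay in `m` beats the linear growth of the block length; the second bound lets half
of `‖ψ‖²` be absorbed in the martingale sum. -/
lemma exists_misplacedBound_le (n : ℕ) {q : ℝ} (hq0 : 0 < q) (hq1 : q < 1) :
    ∃ m : ℕ, misplacedBound n q m ≤ 1 / 4 ∧
      2 * (4 * √(misplacedBound n q m)) ^ 2 * ((2 * (n + m) : ℕ) + 1) ≤ 1 / 2 := by
  have h1 := tendsto_pow_atTop_nhds_zero_of_lt_one hq0.le hq1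
  have h2 := tendsto_self_mul_const_pow_of_lt_one hq0.le hq1
  have hA : Filter.Tendsto (fun m : ℕ => misplacedBound n q m) Filter.atTop (nhds 0) := by
    have := (h1.const_mul ((n : ℝ) ^ 2)).mul_const (1 - q)⁻¹
    simpa [misplacedBound] using this
  have hB : Filter.Tendsto (fun m : ℕ => 2 * (4 * √(misplacedBound n q m)) ^ 2 *
      (((2 * (n + m) : ℕ) : ℝ) + 1)) Filter.atTop (nhds 0) := by
    have h3 := ((h2.const_mul ((n : ℝ) ^ 2 * 2)).mul_const (1 - q)⁻¹).add
      (hA.mul_const (2 * n + 1 : ℝ))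
    have h4 := h3.const_mul (32 : ℝ)
    simp only [mul_zero, zero_mul, add_zero] at h4
    refine h4.congr fun m => ?_
    rw [mul_pow, Real.sq_sqrt (misplacedBound_nonneg hq0 hq1 m)]
    push_cast
    rw [misplacedBound]
    ring
  obtain ⟨m, hm1, hm2⟩ := ((hA.eventually (ge_mem_nhds (show (0 : ℝ) < 1 / 4 by norm_num))).and
    (hB.eventually (ge_mem_nhds (show (0 : ℝ) < 1 / 2 by norm_num)))).exists
  exact ⟨m, hm1, hm2⟩

lemma exists_species_bound (hlam : ∀ i, 0 < lam i) (hlam1 : ∀ i, i ≠ 0 → lam i ≠ 1) :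
    ∃ q : ℝ, 0 < q ∧ q < 1 ∧ ∀ i, i ≠ 0 → lam i ≤ q ∨ 1 ≤ q * lam i := by
  have key (i : Fin (n + 1)) : ∃ q : ℝ, q < 1 ∧
      (i ≠ 0 → ∀ r : ℝ, q ≤ r → lam i ≤ r ∨ 1 ≤ r * lam i) := by
    by_cases hi : i = 0
    · exact ⟨0, by norm_num, fun h => absurd hi h⟩
    · have h0 := hlam i
      rcases lt_or_gt_of_ne (hlam1 i hi) with h | h
      · exact ⟨lam i, h, fun _ r hr => Or.inl hr⟩
      · refine ⟨(lam i)⁻¹, inv_lt_one_of_one_lt₀ h, fun _ r hr => Or.inr ?_⟩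
        rw [inv_le_iff_one_le_mul₀ h0] at hr
        exact hr
  choose q hq1 hq2 using key
  -- The value `1 / 2` only ensures positivity.
  refine ⟨max (1 / 2) (univ.sup' univ_nonempty q), ?_, ?_, fun i hi => ?_⟩
  · exact lt_max_of_lt_left (by norm_num)
  · rw [max_lt_iff]
    exact ⟨by norm_num, (sup'_lt_iff _).2 fun i _ => hq1 i⟩
  · exact hq2 i hi _ (le_max_of_le_right (le_sup' q (mem_univ i)))

/-- Uniform lower bound on the quadratic form of the Hamiltonian. -/
lemma exists_uniform_gap (hlam : ∀ i, 0 < lam i) (hlam0 : lam 0 = 1)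
    (hlam1 : ∀ i, i ≠ 0 → lam i ≠ 1) : ∃ γ : ℝ, 0 < γ ∧ ∀ (N : ℕ) (ψ : Chain n N),
      ψ ∈ (groundSpace lam θ N 0 N)ᗮ →
        γ * ‖ψ‖ ^ 2 ≤ ∑ x ∈ range (N - 1), ‖bond lam θ N x ψ‖ ^ 2 := by
  obtain ⟨q, hq0, hq1, hsp⟩ := exists_species_bound hlam hlam1
  obtain ⟨m₀, hD, hDl⟩ := exists_misplacedBound_le n hq0 hq1
  set l := 2 * (n + m₀) with hl
  set ε := 4 * √(misplacedBound n q m₀) with hε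
  have hε0 : 0 ≤ ε := by positivity
  obtain ⟨C, hC, hgap⟩ := exists_gap_blocks (lam := lam) θ hlam l
  -- The summed steps give `‖ψ‖² ≤ 2 C l F + ‖ψ‖² / 2`, with `F` the sum over the bonds; the summand
  -- 1 guards against `C * l = 0`.
  refine ⟨(4 * C * l + 1)⁻¹, by positivity, fun N ψ hψ => ?_⟩
  set p : ℕ → ℝ := fun m => ‖groundProj lam θ N 0 m ψ‖ ^ 2 with hp
  set f : ℕ → ℝ := fun x => ‖bond lam θ N x ψ‖ ^ 2 with hf
  have hp0 : p 0 = ‖ψ‖ ^ 2 := by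
    simp only [hp]
    rw [groundProj_eq_self]
    intro x _ hx
    omega
  have hpN : p N = 0 := by
    have : groundProj lam θ N 0 N ψ = 0 :=
      (Submodule.starProjection_apply_eq_zero_iff _).2 hψ
    simp [hp, this]
  have hstep (m : ℕ) (hm : m ∈ range N) : p m - p (m + 1) ≤
      2 * (C * ∑ x ∈ Ico (m - l) m, f x) + 2 * ε ^ 2 * (p (m - l) - p (m + 1)) := by
    rw [mem_range] at hm
    refine (norm_sq_step_le θ hlam hε0 (l := l) (m := m) ?_ ψ).trans ?_
    · intro hml u v hu hv hv'
      exact norm_inner_groundSpace_le θ hlam hlam0 hq0 hq1 hsp hlam1 (by omega) hml hD hu hv hv'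
    · have := hgap N (m - l) m (Nat.sub_le _ _) (by omega) (by omega) ψ
      simp only [hp, hf]
      linarith
  have hsum := sum_le_sum hstep
  rw [sum_range_sub', sum_add_distrib, ← mul_sum, ← mul_sum, ← mul_sum, hpN, sub_zero] at hsum
  have htel := sum_range_sub_shift_le (p := p) (fun m => by positivity) N l
  have hf0 : ∀ x, 0 ≤ f x := fun x => by positivity
  -- A bond `x` belongs to the blocks with `x < m ≤ x + l` only.
  have hcount : ∑ m ∈ range N, ∑ x ∈ Ico (m - l) m, f x ≤ l * ∑ x ∈ range (N - 1), f x := by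
    have e1 : ∀ m ∈ range N, ∑ x ∈ Ico (m - l) m, f x =
        ∑ x ∈ range (N - 1), if m - l ≤ x ∧ x < m then f x else 0 := by
      intro m hm
      rw [← sum_filter]
      refine sum_congr ?_ fun _ _ => rfl
      ext x
      simp only [mem_range] at hm
      simp only [mem_Ico, mem_filter, mem_range]
      omega
    rw [sum_congr rfl e1, sum_comm, mul_sum]
    refine sum_le_sum fun x _ => ?_
    rw [← sum_filter, sum_const, nsmul_eq_mul]
    refine mul_le_mul_of_nonneg_right ?_ (hf0 x)
    have hsub : (range N).filter (fun m => m - l ≤ x ∧ x < m) ⊆ Ioc x (x + l) := by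
      intro m hm
      simp only [mem_filter, mem_Ioc] at hm ⊢
      omega
    have := card_le_card hsub
    rw [Nat.card_Ioc, Nat.add_sub_cancel_left] at this
    exact_mod_cast this
  set F := ∑ x ∈ range (N - 1), f x with hF
  have hF0 : 0 ≤ F := sum_nonneg fun x _ => hf0 x
  have hp00 : 0 ≤ p 0 := by positivity
  have h1 : 2 * ε ^ 2 * ∑ m ∈ range N, (p (m - l) - p (m + 1)) ≤ 1 / 2 * p 0 := by
    calc _ ≤ 2 * ε ^ 2 * ((l + 1) * p 0) := by gcongr
      _ = (2 * ε ^ 2 * (l + 1)) * p 0 := by ring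
      _ ≤ _ := by gcongr
  have h2 : C * ∑ m ∈ range N, ∑ x ∈ Ico (m - l) m, f x ≤ C * (l * F) := by gcongr
  rw [inv_mul_le_iff₀ (by positivity), ← hp0]
  nlinarith

end Martingale

/-! ### Ground energy zero, and the gap as a quadratic form bound. -/

section Spectrum

variable {lam : Fin (n + 1) → ℝ} (θ : Fin (n + 1) → Fin (n + 1) → ℝ) {N : ℕ}

lemma hamiltonian_isSymmetric (hlam : ∀ i, 0 < lam i) : (hamiltonian lam θ N).IsSymmetric := by
  intro ψ φ
  rw [hamiltonian_eq_sum_bond, LinearMap.sum_apply, LinearMap.sum_apply, sum_inner, inner_sum]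
  exact sum_congr rfl fun x _ => bond_isSymmetric θ hlam x ψ φ

lemma inner_hamiltonian_self (hlam : ∀ i, 0 < lam i) (ψ : Chain n N) :
    inner ℂ ψ (hamiltonian lam θ N ψ) =
      ((∑ x ∈ range (N - 1), ‖bond lam θ N x ψ‖ ^ 2 : ℝ) : ℂ) := by
  rw [hamiltonian_eq_sum_bond, LinearMap.sum_apply, inner_sum]
  push_cast
  refine sum_congr rfl fun x _ => ?_
  rw [← bond_bond θ hlam, ← bond_isSymmetric θ hlam x, bond_bond θ hlam]
  exact inner_self_eq_norm_sq_to_K (𝕜 := ℂ) _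

lemma mul_norm_sq_of_hasEigenvector (hlam : ∀ i, 0 < lam i) {E : ℝ} {ψ : Chain n N}
    (h : hamiltonian lam θ N ψ = (E : ℂ) • ψ) :
    E * ‖ψ‖ ^ 2 = ∑ x ∈ range (N - 1), ‖bond lam θ N x ψ‖ ^ 2 := by
  have h1 := inner_hamiltonian_self θ hlam ψ
  have h2 : inner ℂ ψ ψ = (‖ψ‖ : ℂ) ^ 2 := inner_self_eq_norm_sq_to_K (𝕜 := ℂ) ψ
  rw [h, inner_smul_right, h2] at h1
  exact_mod_cast h1

lemma energies_nonneg (hlam : ∀ i, 0 < lam i) {E : ℝ} (hE : E ∈ energies (hamiltonian lam θ N)) :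
    0 ≤ E := by
  obtain ⟨ψ, hψ⟩ := Module.End.HasEigenvalue.exists_hasEigenvector hE
  have h := mul_norm_sq_of_hasEigenvector θ hlam hψ.apply_eq_smul
  have hpos : 0 < ‖ψ‖ ^ 2 := by have := norm_pos_iff.2 hψ.2; positivity
  have h0 : 0 ≤ ∑ x ∈ range (N - 1), ‖bond lam θ N x ψ‖ ^ 2 :=
    sum_nonneg fun _ _ => by positivity
  rw [← h] at h0
  exact nonneg_of_mul_nonneg_left h0 hpos

lemma zero_mem_energies (hlam : ∀ i, 0 < lam i) :
    (0 : ℝ) ∈ energies (hamiltonian lam θ N) := by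
  have hvac (x : ℕ) : bond lam θ N x (EuclideanSpace.single (fun _ => 0) 1) = 0 := by
    by_cases hx : x + 1 < N
    swap
    · rw [bond_of_le θ hx]; rfl
    obtain ⟨p, q, hp, hq, hpq⟩ := exists_sites hx
    rw [bond_eq_zero_iff θ hlam hx hp hq]
    intro σ
    have hz (τ : Fin N → Fin (n + 1)) (y : Fin N) (hy : τ y ≠ 0) :
        (EuclideanSpace.single (fun _ => 0) 1 : Chain n N) τ = 0 := by
      simp only [PiLp.single_apply]
      rw [if_neg]
      rintro rfl
      exact hy rfl
    refine ⟨fun _ h => hz σ p h, fun h => ?_⟩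
    by_cases h0 : σ p = 0
    · rw [hz σ q (by rw [← h0]; exact h.symm),
        hz (σ ∘ Equiv.swap p q) p (by simpa [← h0] using h.symm), mul_zero]
    · rw [hz σ p h0, hz (σ ∘ Equiv.swap p q) q (by simpa using h0), mul_zero]
  refine Module.End.hasEigenvalue_of_hasEigenvector
    (x := (EuclideanSpace.single (fun _ => 0) 1 : Chain n N)) ⟨?_, ?_⟩
  · rw [Module.End.mem_eigenspace_iff, hamiltonian_eq_sum_bond, LinearMap.sum_apply]
    simp [hvac]
  · simp

lemma groundEnergy_hamiltonian (hlam : ∀ i, 0 < lam i) :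
    groundEnergy (hamiltonian lam θ N) = 0 :=
  IsLeast.csInf_eq ⟨zero_mem_energies θ hlam, fun _ hE => energies_nonneg θ hlam hE⟩

lemma gap_eq (hlam : ∀ i, 0 < lam i) :
    gap lam θ N = sInf {E ∈ energies (hamiltonian lam θ N) | 0 < E} := by
  rw [gap, spectralGap, groundEnergy_hamiltonian θ hlam, sub_zero]

lemma gap_le_of_mem_energies (hlam : ∀ i, 0 < lam i) {E : ℝ}
    (hE : E ∈ energies (hamiltonian lam θ N)) (hE0 : 0 < E) : gap lam θ N ≤ E := by
  rw [gap_eq θ hlam]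
  exact csInf_le ⟨0, fun _ h => h.2.le⟩ ⟨hE, hE0⟩

/-- By symmetry, an eigenvector with nonzero eigenvalue is orthogonal to the ground space, so the
form bound applies to it. -/
lemma le_of_mem_energies (hlam : ∀ i, 0 < lam i) {γ : ℝ}
    (hγ : ∀ ψ : Chain n N, ψ ∈ (groundSpace lam θ N 0 N)ᗮ →
        γ * ‖ψ‖ ^ 2 ≤ ∑ x ∈ range (N - 1), ‖bond lam θ N x ψ‖ ^ 2) {E : ℝ}
    (hE : E ∈ energies (hamiltonian lam θ N)) (hE0 : 0 < E) : γ ≤ E := by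
  obtain ⟨ψ, hψ⟩ := Module.End.HasEigenvalue.exists_hasEigenvector hE
  have hpos : 0 < ‖ψ‖ ^ 2 := by have := norm_pos_iff.2 hψ.2; positivity
  have horth : ψ ∈ (groundSpace lam θ N 0 N)ᗮ := by
    rw [Submodule.mem_orthogonal]
    intro u hu
    have h0 : hamiltonian lam θ N u = 0 := by
      rw [hamiltonian_eq_sum_bond, LinearMap.sum_apply]
      exact sum_eq_zero fun x hx => hu x (Nat.zero_le _) (by simp at hx; omega)
    have h1 := hamiltonian_isSymmetric θ hlam u ψ
    rw [h0, inner_zero_left, hψ.apply_eq_smul, inner_smul_right] at h1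
    exact (mul_eq_zero.1 h1.symm).resolve_left (by exact_mod_cast hE0.ne')
  have h := hγ ψ horth
  rw [← mul_norm_sq_of_hasEigenvector θ hlam hψ.apply_eq_smul] at h
  exact le_of_mul_le_mul_right h hpos

end Spectrum

/-! ### The one-particle sector and the upper bound. -/

section OneParticle

variable {lam : Fin (n + 1) → ℝ} (θ : Fin (n + 1) → Fin (n + 1) → ℝ) {N : ℕ}

/-- The configuration with one particle `i` at `y`. -/
def oneParticle (N : ℕ) (i : Fin (n + 1)) (y : ℕ) : Fin N → Fin (n + 1) :=
  fun z => if z.val = y then i else 0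

lemma oneParticle_inj {i : Fin (n + 1)} (hi : i ≠ 0) {y z : ℕ} (hy : y < N) :
    oneParticle N i y = oneParticle N i z ↔ y = z := by
  refine ⟨fun h => ?_, fun h => by rw [h]⟩
  have h1 := congrFun h ⟨y, hy⟩
  simp only [oneParticle, if_true] at h1
  by_contra hne
  rw [if_neg hne] at h1
  exact hi h1

variable (lam N) in
/-- The one-particle excitation of the bond at `x`. -/
noncomputable def bondExcitation (i : Fin (n + 1)) (x : ℕ) : Chain n N :=
  EuclideanSpace.single (oneParticle N i (x + 1)) 1 -
    ((lam i : ℂ) ^ 2 / swapRatio lam θ 0 i) • EuclideanSpace.single (oneParticle N i x) 1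

lemma bondExcitation_apply (i : Fin (n + 1)) (x : ℕ) (σ : Fin N → Fin (n + 1)) :
    bondExcitation lam θ N i x σ = (if σ = oneParticle N i (x + 1) then 1 else 0) -
      ((lam i : ℂ) ^ 2 / swapRatio lam θ 0 i) * (if σ = oneParticle N i x then 1 else 0) := by
  simp [bondExcitation, PiLp.single_apply]

/-- A bond without the particle sees only vacuum, so one excited direction remains. Its coefficient
`λ_i² / r` is the conjugate of `r`, as `|r| = λ_i`. -/
lemma bond_oneParticle (hlam : ∀ i, 0 < lam i) (hlam0 : lam 0 = 1) {i : Fin (n + 1)} (hi : i ≠ 0)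
    {x : ℕ} (hx : x + 1 < N) {ψ : Chain n N} (hψ : ∀ σ, (∀ y < N, σ ≠ oneParticle N i y) → ψ σ = 0) :
    bond lam θ N x ψ = ((ψ (oneParticle N i (x + 1)) -
      swapRatio lam θ 0 i * ψ (oneParticle N i x)) / (1 + (lam i : ℂ) ^ 2)) •
        bondExcitation lam θ N i x := by
  obtain ⟨p, q, hp, hq, hpq⟩ := exists_sites hx
  have hr := swapRatio_ne_zero θ hlam 0 i
  have hr' : swapRatio lam θ i 0 = (swapRatio lam θ 0 i)⁻¹ :=
    eq_inv_of_mul_eq_one_left (swapRatio_mul_swapRatio θ hlam i 0)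
  have hl := hlam i
  have hden : (1 + (lam i : ℂ) ^ 2) ≠ 0 := by
    have : (1 + lam i ^ 2) ≠ 0 := by positivity
    exact_mod_cast this
  have hw1 : (swapWeight lam 0 i : ℂ) = 1 / (1 + (lam i : ℂ) ^ 2) := by
    simp [swapWeight, hlam0]
  have hw2 : (swapWeight lam i 0 : ℂ) = (lam i : ℂ) ^ 2 / (1 + (lam i : ℂ) ^ 2) := by
    simp [swapWeight, hlam0, add_comm]
  have o1 : oneParticle N i x p = i := by simp [oneParticle, hp]
  have o2 : oneParticle N i x q = 0 := by simp [oneParticle, hq]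
  have o3 : oneParticle N i (x + 1) p = 0 := by simp [oneParticle, hp]
  have o4 : oneParticle N i (x + 1) q = i := by simp [oneParticle, hq]
  have hoff (y : ℕ) (h1 : y ≠ x) (h2 : y ≠ x + 1) :
      oneParticle N i y p = 0 ∧ oneParticle N i y q = 0 := by
    simp only [oneParticle, hp, hq]
    exact ⟨if_neg (Ne.symm h1), if_neg (Ne.symm h2)⟩
  have s1 : oneParticle N i x ∘ Equiv.swap p q = oneParticle N i (x + 1) := by
    funext z
    simp only [Function.comp_apply, Equiv.swap_apply_def]
    split_ifs with h1 h2
    · rw [o2, h1, o3]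
    · rw [o1, h2, o4]
    · have : z.val ≠ x := fun h => h1 (Fin.ext (by omega))
      have : z.val ≠ x + 1 := fun h => h2 (Fin.ext (by omega))
      simp [oneParticle, *]
  have s2 : oneParticle N i (x + 1) ∘ Equiv.swap p q = oneParticle N i x := by
    rw [← s1, comp_swap_comp_swap]
  ext σ
  rw [bond_apply θ hlam hx hp hq, PiLp.smul_apply, bondExcitation_apply, smul_eq_mul]
  by_cases h1 : σ = oneParticle N i x
  · have hne : oneParticle N i x ≠ oneParticle N i (x + 1) := by
      rw [Ne, oneParticle_inj hi (by omega)]; omega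
    subst h1
    rw [o1, o2, s1, if_neg hi, if_neg hne, if_pos rfl, hr', hw2]
    field_simp
    ring
  by_cases h2 : σ = oneParticle N i (x + 1)
  · subst h2
    rw [o3, o4, s2, if_neg hi.symm, if_pos rfl, if_neg h1, hw1]
    field_simp
    ring
  rw [if_neg h1, if_neg h2, mul_zero, sub_zero, mul_zero]
  split_ifs with h3 h4
  · rfl
  · refine hψ σ fun y _ hy => ?_
    subst hy
    by_cases hyx : y = x
    · exact h1 (by rw [hyx])
    by_cases hyx' : y = x + 1
    · exact h2 (by rw [hyx'])
    exact h4 (hoff y hyx hyx').1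
  · rw [hψ σ, hψ (σ ∘ Equiv.swap p q), mul_zero, sub_zero, mul_zero]
    · intro y _ hy
      by_cases hyx : y = x
      · exact h2 (by rw [← comp_swap_comp_swap σ p q, hy, hyx, s1])
      by_cases hyx' : y = x + 1
      · exact h1 (by rw [← comp_swap_comp_swap σ p q, hy, hyx', s2])
      have e1 := congrFun hy p
      have e2 := congrFun hy q
      rw [(hoff y hyx hyx').1] at e1
      rw [(hoff y hyx hyx').2] at e2
      simp only [Function.comp_apply, Equiv.swap_apply_left, Equiv.swap_apply_right] at e1 e2
      exact h3 (e2.trans e1.symm)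
    · intro y _ hy
      by_cases hyx : y = x
      · exact h1 (by rw [hy, hyx])
      by_cases hyx' : y = x + 1
      · exact h2 (by rw [hy, hyx'])
      exact h3 (by rw [hy, (hoff y hyx hyx').1, (hoff y hyx hyx').2])

/-- The smallest nonzero eigenvalue in the sector with one particle `i`. -/
noncomputable def oneParticleEnergy (l : ℝ) (N : ℕ) : ℝ :=
  1 - 2 / (l⁻¹ + l) * Real.cos (Real.pi / N)

lemma oneParticleEnergy_mem_energies (hlam : ∀ i, 0 < lam i) (hlam0 : lam 0 = 1)
    {i : Fin (n + 1)} (hi : i ≠ 0) (hN : 2 ≤ N) :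
    oneParticleEnergy (lam i) N ∈ energies (hamiltonian lam θ N) := by
  have hl := hlam i
  have hN0 : (N : ℝ) ≠ 0 := by positivity
  set r := swapRatio lam θ 0 i with hrdef
  have hr : r ≠ 0 := swapRatio_ne_zero θ hlam 0 i
  have hlc : (lam i : ℂ) ≠ 0 := by exact_mod_cast hl.ne'
  have hden : (1 + (lam i : ℂ) ^ 2) ≠ 0 := by
    have : (1 + lam i ^ 2) ≠ 0 := by positivity
    exact_mod_cast this
  -- In terms of bond excitations the eigenvalue equation is a three-term recursion with zero
  -- boundary values at 0 and `N`; the phase `r / λ_i` reduces it to the discrete Laplacian, whose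
  -- lowest mode is this sine.
  set A : ℕ → ℂ := fun y => (r / lam i) ^ y * (Real.sin (Real.pi / N * y) : ℝ) with hA
  have hA0 : A 0 = 0 := by simp [hA]
  have hAN : A N = 0 := by
    simp only [hA]
    rw [div_mul_cancel₀ _ hN0, Real.sin_pi]
    simp
  set ψ : Chain n N := ∑ x ∈ range (N - 1), A (x + 1) • bondExcitation lam θ N i x with hψdef
  have hψσ (σ : Fin N → Fin (n + 1)) :
      ψ σ = ∑ x ∈ range (N - 1), A (x + 1) * bondExcitation lam θ N i x σ := by
    rw [hψdef, WithLp.ofLp_sum, Finset.sum_apply]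
    rfl
  have hsupp : ∀ σ, (∀ y < N, σ ≠ oneParticle N i y) → ψ σ = 0 := by
    intro σ hσ
    rw [hψσ]
    refine sum_eq_zero fun x hx => ?_
    rw [mem_range] at hx
    rw [bondExcitation_apply, if_neg (hσ _ (by omega)), if_neg (hσ _ (by omega))]
    ring
  have hval (y : ℕ) (hy : y < N) :
      ψ (oneParticle N i y) = A y - (lam i : ℂ) ^ 2 / r * A (y + 1) := by
    rw [hψσ]
    simp only [bondExcitation_apply, oneParticle_inj hi hy, mul_sub, sum_sub_distrib]
    congr 1
    · rcases y with _ | z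
      · simp [hA0]
      · simp only [add_left_inj, mul_ite, mul_one, mul_zero]
        rw [sum_ite_eq, if_pos (by simp; omega)]
    · have e (x : ℕ) : A (x + 1) * ((lam i : ℂ) ^ 2 / r * if y = x then 1 else 0) =
          if y = x then (lam i : ℂ) ^ 2 / r * A (x + 1) else 0 := by
        split_ifs <;> ring
      simp only [← hrdef, e]
      rw [sum_ite_eq]
      split_ifs with h
      · rfl
      -- The last site starts no bond; the vanishing of `A N` supplies its missing term.
      · rw [show y + 1 = N by simp at h; omega, hAN, mul_zero]
  have hrec (x : ℕ) : (A (x + 1) - (lam i : ℂ) ^ 2 / r * A (x + 2) -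
      r * (A x - (lam i : ℂ) ^ 2 / r * A (x + 1))) / (1 + (lam i : ℂ) ^ 2) =
        (oneParticleEnergy (lam i) N : ℂ) * A (x + 1) := by
    have htrig : Real.sin (Real.pi / N * (x + 2 : ℕ)) + Real.sin (Real.pi / N * x) =
        2 * Real.cos (Real.pi / N) * Real.sin (Real.pi / N * (x + 1 : ℕ)) := by
      have e1 : Real.pi / N * (x + 2 : ℕ) = Real.pi / N * (x + 1 : ℕ) + Real.pi / N := by
        push_cast; ring
      have e2 : Real.pi / N * x = Real.pi / N * (x + 1 : ℕ) - Real.pi / N := by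
        push_cast; ring
      rw [e1, e2, Real.sin_add, Real.sin_sub]
      ring
    have htrig' := congrArg (fun t : ℝ => (t : ℂ)) htrig
    simp only [Complex.ofReal_add, Complex.ofReal_mul, Complex.ofReal_ofNat] at htrig'
    have hE : (oneParticleEnergy (lam i) N : ℂ) =
        (1 + (lam i : ℂ) ^ 2 - 2 * lam i * (Real.cos (Real.pi / N) : ℝ)) /
          (1 + (lam i : ℂ) ^ 2) := by
      have h1 : oneParticleEnergy (lam i) N =
          (1 + lam i ^ 2 - 2 * lam i * Real.cos (Real.pi / N)) / (1 + lam i ^ 2) := by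
        unfold oneParticleEnergy
        field_simp
      rw [h1]
      push_cast
      rfl
    rw [hE, div_mul_eq_mul_div]
    simp only [hA, pow_succ]
    generalize ((Real.sin (Real.pi / N * (x + 2 : ℕ)) : ℝ) : ℂ) = s2 at *
    generalize ((Real.sin (Real.pi / N * (x + 1 : ℕ)) : ℝ) : ℂ) = s1 at *
    generalize ((Real.sin (Real.pi / N * x) : ℝ) : ℂ) = s0 at *
    field_simp
    linear_combination (-(lam i : ℂ)) * htrig'
  refine Module.End.hasEigenvalue_of_hasEigenvector (x := ψ) ⟨?_, ?_⟩
  · rw [Module.End.mem_eigenspace_iff, hamiltonian_eq_sum_bond, LinearMap.sum_apply]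
    conv_rhs => rw [hψdef, smul_sum]
    refine sum_congr rfl fun x hx => ?_
    rw [mem_range] at hx
    rw [bond_oneParticle θ hlam hlam0 hi (by omega) hsupp, hval _ (by omega), hval _ (by omega),
      ← hrdef, hrec, mul_smul]
  · intro h0
    have h1 := hval 0 (by omega)
    rw [h0, hA0, PiLp.zero_apply, zero_sub, eq_comm, neg_eq_zero, zero_add] at h1
    have hs : 0 < Real.sin (Real.pi / N) := by
      apply Real.sin_pos_of_pos_of_lt_pi
      · have := Real.pi_pos; positivity
      · apply div_lt_self Real.pi_pos
        exact_mod_cast (by omega : 1 < N)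
    have hs' : ((Real.sin (Real.pi / N) : ℝ) : ℂ) ≠ 0 := by exact_mod_cast hs.ne'
    have hA1 : A 1 ≠ 0 := by
      simp only [hA, Nat.cast_one, mul_one, pow_one]
      exact mul_ne_zero (div_ne_zero hr hlc) hs'
    exact mul_ne_zero (div_ne_zero (pow_ne_zero 2 hlc) hr) hA1 h1

lemma two_div_inv_add_le_one {l : ℝ} (hl : 0 < l) : 2 / (l⁻¹ + l) ≤ 1 := by
  rw [div_le_one (by positivity)]
  have h : l⁻¹ * l = 1 := inv_mul_cancel₀ hl.ne'
  nlinarith [sq_nonneg (l⁻¹ - l), inv_pos.2 hl, sq_nonneg (l⁻¹ - 1), sq_nonneg (l - 1)]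

lemma oneParticleEnergy_pos {l : ℝ} (hl : 0 < l) (hN : 2 ≤ N) : 0 < oneParticleEnergy l N := by
  have hN' : (2 : ℝ) ≤ N := by exact_mod_cast hN
  have h0 : 0 < Real.pi / N := by have := Real.pi_pos; positivity
  have h1 : Real.pi / N ≤ Real.pi / 2 := by
    have := Real.pi_pos
    gcongr
  have hc : Real.cos (Real.pi / N) < 1 := by
    rw [← Real.cos_zero]
    exact Real.cos_lt_cos_of_nonneg_of_le_pi_div_two le_rfl h1 h0
  have hc0 : 0 ≤ Real.cos (Real.pi / N) :=
    Real.cos_nonneg_of_mem_Icc ⟨by linarith [Real.pi_pos], h1⟩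
  have hs := two_div_inv_add_le_one hl
  have hs0 : 0 < 2 / (l⁻¹ + l) := by positivity
  unfold oneParticleEnergy
  nlinarith

/-- For `N ≥ 4`, combine `(C + 1)(N - C) ≤ (N + 1)² / 4` with `1 - cos t ≤ t² / 2`. This is too weak
for small `N`: at `N = 3` the exact cosine is used, and at `N = 2` also `C > 1`. -/
lemma mul_one_sub_cos_le (hN : 2 ≤ N) {C : ℝ} (hC : 1 < C) (hCN : C < N) :
    (C + 1) * (N - C) * (1 - Real.cos (Real.pi / N)) ≤ 2 := by
  have hamgm : (C + 1) * (N - C) ≤ ((N : ℝ) + 1) ^ 2 / 4 := by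
    nlinarith [sq_nonneg (2 * C + 1 - N)]
  have hcos := Real.cos_le_one (Real.pi / N)
  obtain rfl | rfl | hN4 : N = 2 ∨ N = 3 ∨ 4 ≤ N := by omega
  · norm_num
    nlinarith
  · norm_num at hamgm ⊢
    linarith
  · have hN' : (4 : ℝ) ≤ N := by exact_mod_cast hN4
    have h1 := Real.one_sub_sq_div_two_le_cos (x := Real.pi / N)
    have hpi := Real.pi_lt_d2
    have hpi0 := Real.pi_pos
    have hpi2 : Real.pi ^ 2 ≤ 9.9225 := by nlinarith
    have h2 : 1 - Real.cos (Real.pi / N) ≤ 9.9225 / N ^ 2 / 2 := by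
      have : (Real.pi / N) ^ 2 ≤ 9.9225 / N ^ 2 := by rw [div_pow]; gcongr
      linarith
    calc (C + 1) * (N - C) * (1 - Real.cos (Real.pi / N))
        ≤ (((N : ℝ) + 1) ^ 2 / 4) * (9.9225 / N ^ 2 / 2) :=
          mul_le_mul hamgm h2 (by linarith) (by positivity)
      _ ≤ 2 := by
          rw [div_div, div_mul_div_comm, div_le_iff₀ (by positivity)]
          nlinarith

lemma one_lt_boundConst {l : ℝ} (hl : 0 < l) (hl1 : l ≠ 1) : 1 < boundConst l := by
  have h : 0 < |1 - l| := abs_pos.2 (sub_ne_zero.2 hl1.symm)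
  rw [boundConst, one_lt_div h, abs_lt]
  constructor <;> linarith

lemma oneParticleEnergy_le {l : ℝ} (hl : 0 < l) (hl1 : l ≠ 1) (hN : boundConst l < N) :
    oneParticleEnergy l N ≤
      (1 - 2 / (l⁻¹ + l)) * (1 + (boundConst l - 1) / ((N : ℝ) - boundConst l)) := by
  have hC := one_lt_boundConst hl hl1
  have hN2 : 2 ≤ N := by
    have : (1 : ℝ) < N := hC.trans hN
    have : 1 < N := by exact_mod_cast this
    omega
  set s := 2 / (l⁻¹ + l) with hs
  -- The identity that singles out the constant `C`: it turns the cosine correction into a multiple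
  -- of `1 - s`.
  have hsC : (1 - s) * (boundConst l ^ 2 - 1) = 2 * s := by
    have h1 : s = 2 * l / (1 + l ^ 2) := by
      rw [hs]; field_simp
    have h2 : (1 - l) ≠ 0 := sub_ne_zero.2 hl1.symm
    rw [h1, boundConst, div_pow, sq_abs]
    field_simp
    ring
  have hs1 : s ≤ 1 := two_div_inv_add_le_one hl
  set C := boundConst l with hCdef
  have key := mul_one_sub_cos_le hN2 hC hN
  have hNC : 0 < (N : ℝ) - C := by linarith
  unfold oneParticleEnergy
  have h3 : s * (1 - Real.cos (Real.pi / N)) ≤ (1 - s) * ((C - 1) / (N - C)) := by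
    rw [mul_div_assoc', le_div_iff₀ hNC]
    have h4 : s = (1 - s) * (C ^ 2 - 1) / 2 := by linarith
    calc s * (1 - Real.cos (Real.pi / N)) * (N - C)
        = (1 - s) * (C - 1) / 2 * ((C + 1) * (N - C) * (1 - Real.cos (Real.pi / N))) := by
          conv_lhs => rw [h4]
          ring
      _ ≤ (1 - s) * (C - 1) / 2 * 2 := by
          refine mul_le_mul_of_nonneg_left key ?_
          have : 0 ≤ 1 - s := by linarith
          have : 0 ≤ C - 1 := by linarith
          positivity
      _ = _ := by ring
  rw [← hs]
  linarith

end OneParticle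

end PVBS

theorem proposition2p1 (n : ℕ) (hn : 1 ≤ n)
    (lam : Fin (n + 1) → ℝ) (hlam : ∀ i, 0 < lam i) (hlam0 : lam 0 = 1)
    (θ : Fin (n + 1) → Fin (n + 1) → ℝ) :
    (∀ (N : ℕ) (i : Fin (n + 1)), i ≠ 0 → lam i ≠ 1 → PVBS.boundConst (lam i) < (N : ℝ) →
      PVBS.gap lam θ N ≤
        (1 - 2 / ((lam i)⁻¹ + lam i)) *
          (1 + (PVBS.boundConst (lam i) - 1) / ((N : ℝ) - PVBS.boundConst (lam i)))) ∧
    ((∀ i : Fin (n + 1), i ≠ 0 → lam i ≠ 1) →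
      0 < ⨅ N : {N : ℕ // 2 ≤ N}, PVBS.gap lam θ (N : ℕ)) := by
  constructor
  · intro N i hi hi1 hN
    have hN2 : 2 ≤ N := by
      have : (1 : ℝ) < N := (PVBS.one_lt_boundConst (hlam i) hi1).trans hN
      have : 1 < N := by exact_mod_cast this
      omega
    exact (PVBS.gap_le_of_mem_energies θ hlam
      (PVBS.oneParticleEnergy_mem_energies θ hlam hlam0 hi hN2)
      (PVBS.oneParticleEnergy_pos (hlam i) hN2)).trans
      (PVBS.oneParticleEnergy_le (hlam i) hi1 hN)
  · intro hlam1
    obtain ⟨γ, hγ0, hγ⟩ := PVBS.exists_uniform_gap θ hlam hlam0 hlam1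
    have : Nonempty {N : ℕ // 2 ≤ N} := ⟨⟨2, le_rfl⟩⟩
    refine hγ0.trans_le (le_ciInf fun N => ?_)
    -- A nonvacuum species exists since `1 ≤ n`. Its one-particle energy makes the set of positive
    -- eigenvalues nonempty; the infimum of the empty set would be 0.
    have hlast : Fin.last n ≠ 0 := by
      rw [Ne, Fin.ext_iff]
      simp
      omega
    rw [PVBS.gap_eq θ hlam]
    refine le_csInf ⟨_, PVBS.oneParticleEnergy_mem_energies θ hlam hlam0 hlast N.2,
      PVBS.oneParticleEnergy_pos (hlam _) N.2⟩ fun E hE => ?_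
    exact PVBS.le_of_mem_energies θ hlam (hγ N) hE.1 hE.2
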